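/- For a finite poset $P$ let $\widetilde\chi(P)=\sum_{s}(-1)^{|s|-1}$, the sum over all chains $s$ of $P$ including the empty one, be its reduced Euler characteristic (so $\widetilde\chi(\emptyset)=-1$). For a prime power $q$, a prime $p$ and $n,r\ge 1$ let $$\widetilde\chi^p_r(n,q)=\frac{1}{|\mathrm{GL}_n(\mathbf F_q)|}\sum_{X\in\mathrm{Hom}(\mathbf Z\times\mathbf Z_p^{\,r-1},\,\mathrm{GL}_n(\mathbf F_q))}\widetilde\chi\bigl(C_{L_n^*(\mathbf F_q)}(X)\bigr)$$ be the $r$th $p$-primary equivariant reduced Euler characteristic, where $\mathbf Z_p$ is the ring of $p$-adic integers and $C_{L_n^*(\mathbf F_q)}(X)$ is the poset (under inclusion) of all subspaces $U$ of $\mathbf F_q^n$ with $U\neq 0$ and $U\neq \mathbf F_q^n$ that are invariant under the image of $X$. Say that $u,v\in\mathbf Z_2^\times$ are $2$-equivalent if the subgroups $\langle u\rangle$ and $\langle v\rangle$ have the same closure in $\mathbf Z_2^\times$; for $u\in\mathbf Z_2^\times$, $\widetilde\chi^2_r(n,u)$ stands for the value $\widetilde\chi^2_r(n,q)$ at any odd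 prime power $q$ that is $2$-equivalent to $u$. **Proposition.** For all integers $n\ge 1$, $r\ge 1$, $e>0$ and every odd prime power $q$, the rational number $\widetilde\chi^2_r(n,q)$ is an integer in each of the following cases, and: - if $q$ is $2$-equivalent to $-3$, then $4^{r-1}\mid\widetilde\chi^2_r(n,q)$; - if $q$ is $2$-equivalent to $3^{2^e}$, then $2^{(r-1)(2+e)}\mid\widetilde\chi^2_r(n,q)$; - if $q$ is $2$-equivalent to $3$, then $2^{r-1}\mid\widetilde\chi^2_r(n,q)$; - if $q$ is $2$-equivalent to $-3^{2^e}$ (that is, $-(3^{2^e})$), then $2^{r-1}\mid\widetilde\chi^2_r(n,q)$. That is, $4^{r-1}\mid\widetilde\chi^2_r(n,-3)$, $2^{(r-1)(2+e)}\mid\widetilde\chi^2_r(n,3^{2^e})$, $2^{r-1}\mid\widetilde\chi^2_r(n,3)$ and $2^{r-1}\mid\widetilde\chi^2_r(n,-3^{2^e})$. -/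

import Mathlib

/-- The reduced Euler characteristic of a finite poset `P`: the alternating sum, over all finite
chains `s` of `P` including the empty one, of `(-1)^(dim s)`, where `dim s = |s| - 1`. This is the
reduced Euler characteristic of the order complex; in particular it is `-1` for the empty poset. -/
noncomputable def reducedEulerChar (P : Type*) [PartialOrder P] [Finite P] : ℤ :=
  letI : Fintype P := Fintype.ofFinite P
  letI : DecidablePred fun s : Finset P => IsChain (fun x y => x ≤ y) (s : Set P) :=
    Classical.decPred _
  ∑ s ∈ Finset.univ.filter (fun s : Finset P => IsChain (fun x y => x ≤ y) (s : Set P)),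
    (-1) ^ (s.card + 1)

/-- The group `ℤ × ℤ_p^(r-1)`, written multiplicatively. -/
abbrev PrimarySource (p : ℕ) [Fact p.Prime] (r : ℕ) : Type :=
  Multiplicative (ℤ × (Fin (r - 1) → ℤ_[p]))

/-- The poset of those subspaces of `V`, different from `0` and `V`, that are invariant under
the image of the homomorphism `X : H → GL(V)`. -/
abbrev FixedProperSubspace {H : Type*} [Group H] {F V : Type*} [Field F] [AddCommGroup V]
    [Module F V] (X : H →* LinearMap.GeneralLinearGroup F V) : Type _ :=
  {U : Submodule F V // (U ≠ ⊥ ∧ U ≠ ⊤) ∧ ∀ h : H, U.map (X h : V →ₗ[F] V) = U}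

theorem hom_padicInt_determined (p : ℕ) [Fact p.Prime] {G : Type*} [Group G] [Finite G]
    (f g : Multiplicative ℤ_[p] →* G)
    (h : f (Multiplicative.ofAdd 1) = g (Multiplicative.ofAdd 1)) : f = g := by
  have hp : p.Prime := Fact.out
  obtain ⟨a, m, hm, hN⟩ := Nat.exists_eq_pow_mul_and_not_dvd (n := Nat.card G)
    Nat.card_pos.ne' p hp.ne_one
  have hu : IsUnit ((m : ℕ) : ℤ_[p]) := by
    rw [PadicInt.isUnit_iff, PadicInt.norm_natCast_eq_one_iff]
    exact (Nat.Prime.coprime_iff_not_dvd hp).2 hm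
  obtain ⟨u, hu⟩ := hu
  have key : ∀ (k : Multiplicative ℤ_[p] →* G) (x : ℤ_[p]),
      k (Multiplicative.ofAdd x) = k (Multiplicative.ofAdd 1) ^ (x.appr a) := by
    intro k x
    obtain ⟨z, hz⟩ := Ideal.mem_span_singleton.1 (PadicInt.appr_spec a x)
    have hx : x = (x.appr a) • (1 : ℤ_[p]) + (Nat.card G) • ((u⁻¹ : ℤ_[p]ˣ) * z) := by
      rw [hN, nsmul_eq_mul, nsmul_eq_mul, Nat.cast_mul, ← hu, Nat.cast_pow, mul_one, mul_assoc,
        Units.mul_inv_cancel_left, ← hz]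
      ring
    conv_lhs => rw [hx]
    rw [ofAdd_add, ofAdd_nsmul, ofAdd_nsmul, map_mul, map_pow, map_pow, pow_card_eq_one', mul_one]
  refine MonoidHom.ext fun x => ?_
  have hf := key f (Multiplicative.toAdd x)
  have hg := key g (Multiplicative.toAdd x)
  rw [h] at hf
  exact hf.trans hg.symm

/-- There are only finitely many homomorphisms from `ℤ × ℤ_p^(r-1)` to a finite group. -/
instance finite_primaryHom (p : ℕ) [Fact p.Prime] (r : ℕ) (G : Type*) [Group G] [Finite G] :
    Finite (PrimarySource p r →* G) := by
  let i₁ : Multiplicative ℤ →* PrimarySource p r :=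
    AddMonoidHom.toMultiplicative (AddMonoidHom.inl ℤ (Fin (r - 1) → ℤ_[p]))
  let i₂ : Fin (r - 1) → (Multiplicative ℤ_[p] →* PrimarySource p r) := fun j =>
    AddMonoidHom.toMultiplicative ((AddMonoidHom.inr ℤ (Fin (r - 1) → ℤ_[p])).comp
      (AddMonoidHom.single (fun _ : Fin (r - 1) => ℤ_[p]) j))
  refine Finite.of_injective (β := G × (Fin (r - 1) → G)) (fun X =>
    (X (i₁ (Multiplicative.ofAdd 1)), fun j => X (i₂ j (Multiplicative.ofAdd 1)))) ?_
  intro X Y hXY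
  simp only [Prod.mk.injEq] at hXY
  have h₁ : X.comp i₁ = Y.comp i₁ := MonoidHom.ext_mint hXY.1
  have h₂ : ∀ j, X.comp (i₂ j) = Y.comp (i₂ j) := fun j =>
    hom_padicInt_determined p _ _ (congrFun hXY.2 j)
  have hmem : ∀ a : PrimarySource p r, a ∈ X.eqLocus Y := by
    intro a
    have ha : a = i₁ (Multiplicative.ofAdd (Multiplicative.toAdd a).1) *
        ∏ j, i₂ j (Multiplicative.ofAdd ((Multiplicative.toAdd a).2 j)) := by
      apply Multiplicative.toAdd.injective
      rw [toAdd_mul, toAdd_prod]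
      refine Prod.ext ?_ ?_
      · simp [i₁, i₂, Prod.fst_sum]
      · simp [i₁, i₂, Prod.snd_sum, Finset.univ_sum_single]
    rw [ha]
    exact mul_mem (DFunLike.congr_fun h₁ _) (prod_mem fun j _ => DFunLike.congr_fun (h₂ j) _)
  exact MonoidHom.ext hmem

instance finite_generalLinearGroup (F V : Type*) [Field F] [AddCommGroup V] [Module F V]
    [Finite V] : Finite (LinearMap.GeneralLinearGroup F V) :=
  have : Finite (V →ₗ[F] V) := DFunLike.finite _
  inferInstanceAs (Finite (V →ₗ[F] V)ˣ)

/-- The `r`th `p`-primary equivariant reduced Euler characteristic of the `GL(V)`-poset of proper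
nontrivial subspaces of a finite vector space `V`. -/
noncomputable def primaryEulerChar (p : ℕ) [Fact p.Prime] (r : ℕ) (F V : Type*) [Field F]
    [AddCommGroup V] [Module F V] [Finite V] : ℚ :=
  letI : Fintype (PrimarySource p r →* LinearMap.GeneralLinearGroup F V) := Fintype.ofFinite _
  (1 / (Nat.card (LinearMap.GeneralLinearGroup F V) : ℚ)) *
    ∑ X : PrimarySource p r →* LinearMap.GeneralLinearGroup F V,
      (reducedEulerChar (FixedProperSubspace X) : ℚ)

/-- Two `p`-adic integers are `p`-equivalent if they are units and generate subgroups of `ℤ_p^×`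
with the same closure. -/
def PEquivalent (p : ℕ) [Fact p.Prime] (a b : ℤ_[p]) : Prop :=
  ∃ u v : ℤ_[p]ˣ, (u : ℤ_[p]) = a ∧ (v : ℤ_[p]) = b ∧
    (Subgroup.zpowers u).topologicalClosure = (Subgroup.zpowers v).topologicalClosure

/-! Put q = |F| and V = F^n. A homomorphism from ℤ × ℤ_2^(r-1) to GL(V) factors through ℤ × Q with Q
= (ℤ/2^N)^(r-1) and N large, and a homomorphism from ℤ × Q is a representation Y of Q on V with an
automorphism g of the F[Q]-module V. The invariant subspaces are the submodules fixed by g. By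
orbit-stabilizer, the Euler characteristic is thus a sum over isomorphism classes of F[Q]-modules of
dimension n, each weighted by the mean over g of the Möbius number of the lattice of g-fixed
submodules.

F[Q] is semisimple by Maschke. Averaging the Möbius recursion over g turns it into the recursion of
a product of chains, one for each simple module, so the mean is (-1)^k if the module is a sum of k
distinct simples and 0 otherwise (`meanMu_eq_prod`). Hence the Euler characteristic is the
coefficient of X^n in ∏ (1 - X^d_i), where the d_i are the degrees of the simple modules
(`sum_reducedEulerChar_hom`). In particular it is an integer.

Counting the points of F[Q] over the extension of degree 2^j shows that the d_i dividing 2^j have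
sum 2^((r-1) v_j), where v_j is the 2-adic valuation of q^(2^j) - 1, as long as v_j ≤ N. This forces
the product to be congruent to a power of 1 - X^(2^j0) modulo 2^((r-1) v_0)
(`two_pow_dvd_prod_sub`). If n < 2^j0, then 2^((r-1) v_0) divides the coefficient. It remains to
bound v_0, the valuation of q - 1, from below by the 2-equivalence class of q. -/

/-! ### Euler characteristics of posets and their recursion. -/

section EulerChar

open Classical in
theorem reducedEulerChar_eq_sum (P : Type*) [PartialOrder P] [Fintype P] :
    reducedEulerChar P =
      ∑ s ∈ Finset.univ.filter (fun s : Finset P => IsChain (fun x y => x ≤ y) (s : Set P)),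
        (-1) ^ (s.card + 1) := by
  unfold reducedEulerChar
  have h : Fintype.ofFinite P = ‹Fintype P› := Subsingleton.elim _ _
  rw [h]

open Classical in
theorem reducedEulerChar_congr {P Q : Type*} [PartialOrder P] [Finite P] [PartialOrder Q]
    [Finite Q] (e : P ≃o Q) : reducedEulerChar P = reducedEulerChar Q := by
  have := Fintype.ofFinite P
  have := Fintype.ofFinite Q
  rw [reducedEulerChar_eq_sum, reducedEulerChar_eq_sum]
  refine Finset.sum_equiv e.toEquiv.finsetCongr (fun s => ?_) fun s _ => ?_
  · simp only [Finset.mem_filter, Finset.mem_univ, true_and, Equiv.finsetCongr_apply,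
      Finset.coe_map]
    constructor
    · intro h
      rintro _ ⟨x, hx, rfl⟩ _ ⟨y, hy, rfl⟩ hxy
      have := h hx hy (fun h => hxy (by rw [h]))
      simpa using this
    · intro h x hx y hy hxy
      have := h (Set.mem_image_of_mem _ hx) (Set.mem_image_of_mem _ hy) (by simpa using hxy)
      simpa using this
  · simp

open Classical in
/-- Sorting the chains by their largest element. -/
theorem reducedEulerChar_eq_neg_one_sub (P : Type*) [PartialOrder P] [Fintype P] :
    reducedEulerChar P = -1 - ∑ u : P, reducedEulerChar {x : P // x < u} := by
  let C : Finset (Finset P) :=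
    Finset.univ.filter fun s : Finset P => IsChain (fun x y => x ≤ y) (s : Set P)
  let T : P → Finset (Finset P) := fun u => C.filter fun s => u ∈ s ∧ ∀ x ∈ s, x ≤ u
  have hC : C = insert ∅ (Finset.univ.biUnion T) := by
    ext s
    simp only [C, T, Finset.mem_insert, Finset.mem_biUnion, Finset.mem_filter, Finset.mem_univ,
      true_and]
    constructor
    · intro hs
      rcases s.eq_empty_or_nonempty with h | h
      · exact Or.inl h
      · obtain ⟨u, hu⟩ := s.exists_maximal h
        refine Or.inr ⟨u, hs, hu.1, fun x hx => ?_⟩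
        rcases hs.total hx hu.1 with h | h
        · exact h
        · exact hu.2 hx h
    · rintro (rfl | ⟨u, h, -⟩)
      · simp
      · exact h
  have hdisj : ((Finset.univ : Finset P) : Set P).PairwiseDisjoint T := by
    intro u _ v _ huv
    refine Finset.disjoint_left.2 fun s hs hs' => huv ?_
    simp only [T, Finset.mem_filter] at hs hs'
    exact le_antisymm (hs'.2.2 u hs.2.1) (hs.2.2 v hs'.2.1)
  -- Removing the largest element u leaves a chain strictly below u with one element fewer, whence
  -- the sign.
  have hT : ∀ u, ∑ s ∈ T u, (-1 : ℤ) ^ (s.card + 1) = - reducedEulerChar {x : P // x < u} := by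
    intro u
    rw [reducedEulerChar_eq_sum, ← Finset.sum_neg_distrib]
    symm
    refine Finset.sum_bij (fun s _ => insert u (s.map (Function.Embedding.subtype _))) ?_ ?_ ?_ ?_
    · intro s hs
      simp only [Finset.mem_filter, Finset.mem_univ, true_and] at hs
      simp only [T, C, Finset.mem_filter, Finset.mem_univ, true_and]
      refine ⟨?_, Finset.mem_insert_self _ _, ?_⟩
      · intro x hx y hy hxy
        simp only [Finset.coe_insert, Finset.coe_map, Set.mem_insert_iff, Set.mem_image] at hx hy
        rcases hx with rfl | ⟨x, hx, rfl⟩ <;> rcases hy with rfl | ⟨y, hy, rfl⟩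
        · exact absurd rfl hxy
        · exact Or.inr y.2.le
        · exact Or.inl x.2.le
        · exact hs hx hy (fun h => hxy (by rw [h]))
      · intro x hx
        simp only [Finset.mem_insert, Finset.mem_map] at hx
        rcases hx with rfl | ⟨x, -, rfl⟩
        · exact le_rfl
        · exact x.2.le
    · intro s _ s' _ h
      have hn : ∀ s : Finset {x : P // x < u}, u ∉ s.map (Function.Embedding.subtype _) := by
        intro s hs
        obtain ⟨x, -, hx⟩ := Finset.mem_map.1 hs
        exact x.2.ne hx
      have := congrArg (fun s => Finset.erase s u) h
      simp only [Finset.erase_insert (hn _)] at this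
      exact Finset.map_injective _ this
    · intro s hs
      simp only [T, C, Finset.mem_filter, Finset.mem_univ, true_and] at hs
      obtain ⟨hs, hu, hle⟩ := hs
      refine ⟨(s.erase u).subtype (· < u), ?_, ?_⟩
      · simp only [Finset.mem_filter, Finset.mem_univ, true_and]
        intro x hx y hy hxy
        simp only [Finset.mem_coe, Finset.mem_subtype, Finset.mem_erase] at hx hy
        exact hs hx.2 hy.2 (fun h => hxy (Subtype.ext h))
      · rw [Finset.subtype_map_of_mem, Finset.insert_erase hu]
        intro x hx
        exact lt_of_le_of_ne (hle x (Finset.mem_of_mem_erase hx)) (Finset.ne_of_mem_erase hx)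
    · intro s _
      rw [Finset.card_insert_of_notMem, Finset.card_map]
      · ring
      · intro hs
        obtain ⟨x, -, hx⟩ := Finset.mem_map.1 hs
        exact x.2.ne hx
  have hne : ∅ ∉ Finset.univ.biUnion T := by simp [T]
  rw [reducedEulerChar_eq_sum]
  change ∑ s ∈ C, (-1 : ℤ) ^ (s.card + 1) = _
  rw [hC, Finset.sum_insert hne, Finset.sum_biUnion hdisj, Finset.sum_congr rfl fun u _ => hT u,
    Finset.sum_neg_distrib]
  simp [sub_eq_add_neg]

end EulerChar

/-! ### Möbius numbers of fixed-submodule lattices and their mean over automorphisms. -/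

section Mean

/-- Orbit-stabilizer: each orbit, labelled by its value of `φ`, contributes |G| times its weight. It
is applied to submodules under module automorphisms and to representations under conjugation, with
multiplicities as labels. -/
theorem sum_card_stabilizer_mul {G Ω T : Type*} [DecidableEq T] [Group G] [Finite G] [Fintype Ω] [MulAction G Ω]
    (φ : Ω → T) (hφ : ∀ x y, φ x = φ y ↔ x ∈ MulAction.orbit G y) (w : T → ℚ) :
    ∑ x, (Nat.card (MulAction.stabilizer G x) : ℚ) * w (φ x) =
      Nat.card G * ∑ τ ∈ Finset.univ.image φ, w τ := by
  rw [Finset.mul_sum]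
  symm
  refine Finset.sum_image' _ fun x _ => ?_
  have h : ∀ y ∈ Finset.univ.filter (fun y => φ y = φ x),
      (Nat.card (MulAction.stabilizer G y) : ℚ) * w (φ y) =
        Nat.card (MulAction.stabilizer G x) * w (φ x) := by
    intro y hy
    have hy := (Finset.mem_filter.1 hy).2
    rw [hy, Nat.card_congr (MulAction.stabilizerEquivStabilizerOfOrbitRel
      (MulAction.orbitRel_apply.2 ((hφ y x).1 hy))).toEquiv]
  have hc : (Finset.univ.filter (fun y => φ y = φ x)).card = Nat.card (MulAction.orbit G x) := by
    classical
    rw [Nat.card_eq_fintype_card, Fintype.card_subtype]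
    congr 1
    ext y
    simp [hφ]
  rw [Finset.sum_congr rfl h, Finset.sum_const, hc, nsmul_eq_mul, ← mul_assoc, ← Nat.cast_mul,
    ← Nat.card_prod, Nat.card_congr (MulAction.orbitProdStabilizerEquivGroup G x)]

variable {A V V' : Type*} [CommRing A] [AddCommGroup V] [Module A V] [AddCommGroup V']
  [Module A V']

instance finite_submodule [Finite V] : Finite (Submodule A V) :=
  Finite.of_injective (fun U : Submodule A V => (U : Set V)) SetLike.coe_injective

instance finite_linearEquiv [Finite V] [Finite V'] : Finite (V ≃ₗ[A] V') :=
  Finite.of_injective (fun g : V ≃ₗ[A] V' => (g : V → V')) DFunLike.coe_injective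

/-- The proper nonzero submodules fixed by an automorphism. -/
abbrev FixedProper (g : V ≃ₗ[A] V) : Type _ :=
  {U : Submodule A V // (U ≠ ⊥ ∧ U ≠ ⊤) ∧ U.map (g : V →ₗ[A] V) = U}

open Classical in
/-- The Möbius number of the lattice of submodules fixed by an automorphism. -/
noncomputable def autMu [Finite V] (g : V ≃ₗ[A] V) : ℤ :=
  if Subsingleton V then 1 else reducedEulerChar (FixedProper g)

/-- The zero module has no proper nonzero submodules, so the Euler characteristic would give -1; the
recursion needs the Möbius value μ(0,0) = 1. -/
theorem autMu_of_subsingleton [Finite V] [Subsingleton V] (g : V ≃ₗ[A] V) : autMu g = 1 :=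
  if_pos ‹_›

theorem autMu_of_nontrivial [Finite V] [Nontrivial V] (g : V ≃ₗ[A] V) :
    autMu g = reducedEulerChar (FixedProper g) :=
  if_neg (not_subsingleton V)

theorem map_fixed_iff (e : V ≃ₗ[A] V') {g : V ≃ₗ[A] V} {g' : V' ≃ₗ[A] V'}
    (h : ∀ v, e (g v) = g' (e v)) (U : Submodule A V) :
    (U.map (e : V →ₗ[A] V')).map (g' : V' →ₗ[A] V') = U.map (e : V →ₗ[A] V') ↔
      U.map (g : V →ₗ[A] V) = U := by
  have h' : (g' : V' →ₗ[A] V') ∘ₗ (e : V →ₗ[A] V') = (e : V →ₗ[A] V') ∘ₗ (g : V →ₗ[A] V) :=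
    LinearMap.ext fun v => (h v).symm
  rw [← Submodule.map_comp, h', Submodule.map_comp]
  exact (Submodule.map_injective_of_injective e.injective).eq_iff

theorem autMu_congr [Finite V] [Finite V'] (e : V ≃ₗ[A] V') {g : V ≃ₗ[A] V} {g' : V' ≃ₗ[A] V'}
    (h : ∀ v, e (g v) = g' (e v)) : autMu g = autMu g' := by
  cases subsingleton_or_nontrivial V with
  | inl h1 =>
    have := e.symm.injective.subsingleton
    rw [autMu_of_subsingleton, autMu_of_subsingleton]
  | inr h1 =>
    have := e.injective.nontrivial
    rw [autMu_of_nontrivial, autMu_of_nontrivial]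
    refine reducedEulerChar_congr ?_
    refine ⟨(Submodule.orderIsoMapComap e).toEquiv.subtypeEquiv fun U => ?_,
      fun {U W} => (Submodule.orderIsoMapComap e).le_iff_le (x := U.1) (y := W.1)⟩
    change _ ↔ (U.map (e : V →ₗ[A] V') ≠ ⊥ ∧ U.map (e : V →ₗ[A] V') ≠ ⊤) ∧ _
    refine and_congr (and_congr ?_ ?_) (map_fixed_iff e h U).symm
    · exact (map_eq_bot_iff (a := U) (Submodule.orderIsoMapComap e)).not.symm
    · exact (map_eq_top_iff (a := U) (Submodule.orderIsoMapComap e)).not.symm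

/-- The restriction of an automorphism to a fixed submodule. -/
def restrictAut (g : V ≃ₗ[A] V) (U : Submodule A V) (h : U.map (g : V →ₗ[A] V) = U) : U ≃ₗ[A] U :=
  g.ofSubmodules U U h

theorem map_subtype_fixed_iff (g : V ≃ₗ[A] V) (U : Submodule A V)
    (h : U.map (g : V →ₗ[A] V) = U) (W : Submodule A U) :
    (W.map U.subtype).map (g : V →ₗ[A] V) = W.map U.subtype ↔
      W.map (restrictAut g U h : U →ₗ[A] U) = W := by
  have h' : (g : V →ₗ[A] V) ∘ₗ U.subtype = U.subtype ∘ₗ (restrictAut g U h : U →ₗ[A] U) :=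
    LinearMap.ext fun v => rfl
  rw [← Submodule.map_comp, h', Submodule.map_comp]
  exact (Submodule.map_injective_of_injective U.injective_subtype).eq_iff

/-- The proper nonzero submodules of U fixed by the restriction are those of V fixed by g and
strictly below U. This gives the terms of `reducedEulerChar_eq_neg_one_sub` a module-theoretic
meaning. -/
theorem autMu_restrictAut [Finite V] (g : V ≃ₗ[A] V) (U : FixedProper g) :
    autMu (restrictAut g U.1 U.2.2) = reducedEulerChar {x : FixedProper g // x < U} := by
  have : Nontrivial U.1 := Submodule.nontrivial_iff_ne_bot.2 U.2.1.1
  rw [autMu_of_nontrivial]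
  have hlt : ∀ {W : Submodule A U.1}, W ≠ ⊤ → W.map U.1.subtype < U.1 := fun {W} hW =>
    lt_of_le_of_ne (Submodule.map_subtype_le _ _) fun h => hW (by
      apply Submodule.map_injective_of_injective U.1.injective_subtype
      rw [h, Submodule.map_subtype_top])
  refine reducedEulerChar_congr
    { toFun := fun W => ⟨⟨W.1.map U.1.subtype, ⟨?_, ?_⟩, ?_⟩, hlt W.2.1.2⟩
      invFun := fun W => ⟨W.1.1.comap U.1.subtype, ⟨?_, ?_⟩, ?_⟩
      left_inv := fun W => ?_
      right_inv := fun W => ?_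
      map_rel_iff' := ?_ }
  · intro h
    exact W.2.1.1 (Submodule.map_injective_of_injective U.1.injective_subtype
      (h.trans (Submodule.map_bot _).symm))
  · exact ((hlt W.2.1.2).trans_le le_top).ne
  · exact (map_subtype_fixed_iff g U.1 U.2.2 W.1).2 W.2.2
  · intro h
    apply W.1.2.1.1
    have := Submodule.map_comap_subtype U.1 W.1.1
    rw [h, Submodule.map_bot, inf_eq_right.2 (show W.1.1 ≤ U.1 from W.2.le)] at this
    exact this.symm
  · intro h
    exact not_le_of_gt W.2 (Submodule.comap_subtype_eq_top.1 h)
  · rw [← map_subtype_fixed_iff g U.1 U.2.2, Submodule.map_comap_subtype,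
      inf_eq_right.2 (show W.1.1 ≤ U.1 from W.2.le)]
    exact W.1.2.2
  · exact Subtype.ext (Submodule.comap_map_eq_of_injective U.1.injective_subtype _)
  · refine Subtype.ext (Subtype.ext ?_)
    change (W.1.1.comap U.1.subtype).map U.1.subtype = W.1.1
    rw [Submodule.map_comap_subtype, inf_eq_right.2 (show W.1.1 ≤ U.1 from W.2.le)]
  · intro W W'
    exact Submodule.map_le_map_iff_of_injective U.1.injective_subtype _ _

open Classical in
-- The defining relation ∑ μ(0,U) = 0 of the Möbius function on the lattice of g-fixed submodules.
theorem sum_autMu_restrictAut [Finite V] [Nontrivial V] (g : V ≃ₗ[A] V)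
    [Fintype {U : Submodule A V // U.map (g : V →ₗ[A] V) = U}] :
    ∑ U : {U : Submodule A V // U.map (g : V →ₗ[A] V) = U}, autMu (restrictAut g U.1 U.2) = 0 := by
  have := Fintype.ofFinite (FixedProper g)
  let b : {U : Submodule A V // U.map (g : V →ₗ[A] V) = U} := ⟨⊥, Submodule.map_bot _⟩
  let t : {U : Submodule A V // U.map (g : V →ₗ[A] V) = U} :=
    ⟨⊤, by rw [Submodule.map_top]; exact g.range⟩
  have hb : autMu (restrictAut g b.1 b.2) = 1 := by
    have : Subsingleton b.1 := inferInstanceAs (Subsingleton (⊥ : Submodule A V))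
    exact autMu_of_subsingleton _
  have ht : autMu (restrictAut g t.1 t.2) = autMu g :=
    autMu_congr Submodule.topEquiv fun v => rfl
  have hbt : b ≠ t := fun h => bot_ne_top (congrArg Subtype.val h)
  have hu : (Finset.univ : Finset {U : Submodule A V // U.map (g : V →ₗ[A] V) = U}) =
      insert b (insert t (Finset.univ.filter fun U => U.1 ≠ ⊥ ∧ U.1 ≠ ⊤)) := by
    ext U
    simp only [Finset.mem_univ, Finset.mem_insert, Finset.mem_filter, true_and, true_iff]
    by_cases h1 : U.1 = ⊥
    · exact Or.inl (Subtype.ext h1)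
    by_cases h2 : U.1 = ⊤
    · exact Or.inr (Or.inl (Subtype.ext h2))
    exact Or.inr (Or.inr ⟨h1, h2⟩)
  rw [hu, Finset.sum_insert, Finset.sum_insert, hb, ht, autMu_of_nontrivial,
    reducedEulerChar_eq_neg_one_sub, Finset.sum_congr rfl fun u _ => (autMu_restrictAut g u).symm]
  · have : ∑ U ∈ Finset.univ.filter
        (fun U : {U : Submodule A V // U.map (g : V →ₗ[A] V) = U} => U.1 ≠ ⊥ ∧ U.1 ≠ ⊤),
        autMu (restrictAut g U.1 U.2) =
        ∑ U : FixedProper g, autMu (restrictAut g U.1 U.2.2) := by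
      refine Finset.sum_bij' (fun U h => ⟨U.1, (Finset.mem_filter.1 h).2, U.2⟩)
        (fun U _ => ⟨U.1, U.2.2⟩) ?_ ?_ ?_ ?_ ?_
      · intros; exact Finset.mem_univ _
      · intro U _; exact Finset.mem_filter.2 ⟨Finset.mem_univ _, U.2.1⟩
      · intros; rfl
      · intros; rfl
      · intros; rfl
    rw [this]
    ring
  · simp [t]
  · simp [b, hbt]

open Classical in
/-- The average of the Möbius numbers of the automorphisms. -/
noncomputable def meanMu (A V : Type*) [CommRing A] [AddCommGroup V] [Module A V] [Finite V] : ℚ :=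
  letI := Fintype.ofFinite (V ≃ₗ[A] V)
  (∑ g : V ≃ₗ[A] V, (autMu g : ℚ)) / Nat.card (V ≃ₗ[A] V)

theorem card_mul_meanMu [Finite V] [Fintype (V ≃ₗ[A] V)] :
    Nat.card (V ≃ₗ[A] V) * meanMu A V = ∑ g : V ≃ₗ[A] V, (autMu g : ℚ) := by
  have h : (Nat.card (V ≃ₗ[A] V) : ℚ) ≠ 0 := Nat.cast_ne_zero.2 Nat.card_pos.ne'
  rw [meanMu, mul_div_cancel₀ _ h]
  congr!

theorem meanMu_of_subsingleton [Finite V] [Subsingleton V] : meanMu A V = 1 := by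
  have := Fintype.ofFinite (V ≃ₗ[A] V)
  have h : (Nat.card (V ≃ₗ[A] V) : ℚ) ≠ 0 := Nat.cast_ne_zero.2 Nat.card_pos.ne'
  refine mul_left_cancel₀ h ?_
  rw [card_mul_meanMu]
  simp [autMu_of_subsingleton]

/-- Conjugation by an isomorphism. -/
def conjAut (e : V ≃ₗ[A] V') : (V ≃ₗ[A] V) ≃ (V' ≃ₗ[A] V') where
  toFun g := (e.symm.trans g).trans e
  invFun g := (e.trans g).trans e.symm
  left_inv g := by ext; simp
  right_inv g := by ext; simp

theorem meanMu_congr [Finite V] [Finite V'] (e : V ≃ₗ[A] V') : meanMu A V = meanMu A V' := by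
  have := Fintype.ofFinite (V ≃ₗ[A] V)
  have := Fintype.ofFinite (V' ≃ₗ[A] V')
  have h : (Nat.card (V ≃ₗ[A] V) : ℚ) ≠ 0 := Nat.cast_ne_zero.2 Nat.card_pos.ne'
  refine mul_left_cancel₀ h ?_
  rw [card_mul_meanMu, Nat.card_congr (conjAut e), card_mul_meanMu]
  refine Fintype.sum_equiv (conjAut e) _ _ fun g => ?_
  rw [autMu_congr e (g := g) (g' := conjAut e g) fun v => by simp [conjAut]]

open scoped Pointwise

/-- The restriction of the automorphisms fixing a submodule. -/
def restrictAutHom (U : Submodule A V) :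
    MulAction.stabilizer (V ≃ₗ[A] V) U →* (U ≃ₗ[A] U) where
  toFun g := restrictAut g.1 U g.2
  map_one' := rfl
  map_mul' _ _ := rfl

/-- An automorphism of U extends by the identity on a complement. -/
theorem restrictAutHom_surjective (U : Submodule A V) (hU : ∃ W, IsCompl U W) :
    Function.Surjective (restrictAutHom U) := by
  obtain ⟨W, hW⟩ := hU
  intro k
  let e := Submodule.prodEquivOfIsCompl U W hW
  let g : V ≃ₗ[A] V := (e.symm.trans (k.prodCongr (LinearEquiv.refl A W))).trans e
  have hg : ∀ u : U, g u = k u := fun u => by simp [g, e]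
  have hgU : U.map (g : V →ₗ[A] V) = U := by
    ext v
    constructor
    · rintro ⟨u, hu, rfl⟩
      exact (hg ⟨u, hu⟩).symm ▸ (k ⟨u, hu⟩).2
    · intro hv
      refine ⟨k.symm ⟨v, hv⟩, (k.symm ⟨v, hv⟩).2, ?_⟩
      change g _ = v
      rw [hg]
      simp
  refine ⟨⟨g, hgU⟩, ?_⟩
  ext u
  exact hg u

theorem sum_comp_of_surjective {G H : Type*} [Group G] [Group H] [Fintype G] [Fintype H]
    (f : G →* H) (hf : Function.Surjective f) (w : H → ℚ) :
    (Nat.card H : ℚ) * ∑ g, w (f g) = Nat.card G * ∑ h, w h := by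
  classical
  have h1 : ∀ h : H, (Finset.univ.filter fun g => f g = h).card = Nat.card f.ker := by
    intro h
    rw [Nat.card_eq_fintype_card, Fintype.card_subtype]
    obtain ⟨g0, rfl⟩ := hf h
    refine Finset.card_bij (fun g _ => g0⁻¹ * g) ?_ ?_ ?_
    · intro g hg
      have := (Finset.mem_filter.1 hg).2
      simp [MonoidHom.mem_ker, this]
    · intro g _ g' _ h
      simpa using h
    · intro k hk
      have hk : f k = 1 := (Finset.mem_filter.1 hk).2
      exact ⟨g0 * k, by simp [hk], by simp⟩
  have h2 : Nat.card G = Nat.card H * Nat.card f.ker := by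
    rw [Subgroup.card_eq_card_quotient_mul_card_subgroup f.ker,
      Nat.card_congr (QuotientGroup.quotientKerEquivOfSurjective f hf).toEquiv]
  have h3 : ∑ g, w (f g) = ∑ h, (Nat.card f.ker : ℚ) * w h := by
    rw [← Finset.sum_fiberwise (s := Finset.univ) (g := f)]
    refine Finset.sum_congr rfl fun h _ => ?_
    rw [Finset.sum_congr rfl (g := fun _ => w h), Finset.sum_const, h1, nsmul_eq_mul]
    intro g hg
    rw [(Finset.mem_filter.1 hg).2]
  rw [h3, h2, ← Finset.mul_sum]
  push_cast
  ring

open Classical in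
-- The fibres of the surjection from the stabilizer of U to Aut U have equal size, so averaging over
-- the stabilizer is averaging over Aut U.
theorem sum_stabilizer_autMu [Finite V] (U : Submodule A V) (hU : ∃ W, IsCompl U W)
    [Fintype (MulAction.stabilizer (V ≃ₗ[A] V) U)] :
    ∑ g : MulAction.stabilizer (V ≃ₗ[A] V) U, (autMu (restrictAut g.1 U g.2) : ℚ) =
      Nat.card (MulAction.stabilizer (V ≃ₗ[A] V) U) * meanMu A U := by
  have := Fintype.ofFinite (U ≃ₗ[A] U)
  have h : (Nat.card (U ≃ₗ[A] U) : ℚ) ≠ 0 := Nat.cast_ne_zero.2 Nat.card_pos.ne'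
  refine mul_left_cancel₀ h ?_
  have := sum_comp_of_surjective (restrictAutHom U) (restrictAutHom_surjective U hU)
    fun g => (autMu g : ℚ)
  rw [mul_left_comm, card_mul_meanMu, ← this]
  rfl

open Classical in
-- Sum the Möbius relation over all g and exchange the sums over g and U.
theorem sum_card_stabilizer_mul_meanMu [Finite V] [Nontrivial V] [Fintype (Submodule A V)]
    (hV : ∀ U : Submodule A V, ∃ W, IsCompl U W) :
    ∑ U : Submodule A V,
      (Nat.card (MulAction.stabilizer (V ≃ₗ[A] V) U) : ℚ) * meanMu A U = 0 := by
  have := Fintype.ofFinite (V ≃ₗ[A] V)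
  have h1 : ∀ U : Submodule A V,
      (Nat.card (MulAction.stabilizer (V ≃ₗ[A] V) U) : ℚ) * meanMu A U =
      ∑ g : V ≃ₗ[A] V, if h : U.map (g : V →ₗ[A] V) = U then (autMu (restrictAut g U h) : ℚ)
        else 0 := by
    intro U
    rw [← sum_stabilizer_autMu U (hV U), Finset.sum_dite, Finset.sum_const_zero, add_zero]
    refine Finset.sum_bij' (fun g _ => ⟨g.1, Finset.mem_filter.2 ⟨Finset.mem_univ _, g.2⟩⟩)
      (fun g _ => ⟨g.1, (Finset.mem_filter.1 g.2).2⟩) ?_ ?_ ?_ ?_ ?_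
    · intros; exact Finset.mem_attach _ _
    · intros; exact Finset.mem_univ _
    · intros; rfl
    · intros; rfl
    · intros; rfl
  rw [Finset.sum_congr rfl fun U _ => h1 U, Finset.sum_comm]
  refine Finset.sum_eq_zero fun g _ => ?_
  have h2 := sum_autMu_restrictAut g
  rw [Finset.sum_dite, Finset.sum_const_zero, add_zero]
  rw [← Int.cast_inj (α := ℚ), Int.cast_sum, Int.cast_zero] at h2
  rw [← h2]
  refine Finset.sum_bij' (fun U _ => ⟨U.1, (Finset.mem_filter.1 U.2).2⟩)
    (fun U _ => ⟨U.1, Finset.mem_filter.2 ⟨Finset.mem_univ _, U.2⟩⟩) ?_ ?_ ?_ ?_ ?_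
  · intros; exact Finset.mem_univ _
  · intros; exact Finset.mem_attach _ _
  · intros; rfl
  · intros; rfl
  · intros; rfl

end Mean

/-! ### Semisimple modules, their multiplicities, and the value of the mean. -/

section Mult

open scoped Pointwise

variable {A V W : Type*} [CommRing A] [AddCommGroup V] [Module A V] [AddCommGroup W] [Module A W]

noncomputable instance fieldQuotMaximal (i : MaximalSpectrum A) : Field (A ⧸ i.asIdeal) :=
  Ideal.Quotient.field i.asIdeal

/-- The multiplicity of the simple module `A ⧸ i`. -/
noncomputable def mult (A V : Type*) [CommRing A] [AddCommGroup V] [Module A V]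
    (i : MaximalSpectrum A) : ℕ :=
  Module.finrank (A ⧸ i.asIdeal) (V →ₗ[A] (A ⧸ i.asIdeal))

theorem mult_congr (e : V ≃ₗ[A] W) : mult A V = mult A W := by
  funext i
  exact (LinearEquiv.congrLeft (A ⧸ i.asIdeal) (A ⧸ i.asIdeal) e).finrank_eq

instance finite_quot_maximal [Finite A] (i : MaximalSpectrum A) : Finite (A ⧸ i.asIdeal) :=
  Finite.of_surjective _ Ideal.Quotient.mk_surjective

instance finite_hom_quot [Finite V] [Finite A] (i : MaximalSpectrum A) :
    Module.Finite (A ⧸ i.asIdeal) (V →ₗ[A] (A ⧸ i.asIdeal)) :=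
  have : Finite (V →ₗ[A] (A ⧸ i.asIdeal)) := DFunLike.finite _
  Module.Finite.of_finite

theorem mult_prod [Finite A] [Finite V] [Finite W] : mult A (V × W) = mult A V + mult A W := by
  funext i
  rw [Pi.add_apply, mult, mult, mult, ← Module.finrank_prod]
  exact (LinearMap.coprodEquiv (A ⧸ i.asIdeal)).finrank_eq.symm

theorem mult_quot_self [Finite A] (i : MaximalSpectrum A) : mult A (A ⧸ i.asIdeal) i = 1 := by
  rw [mult, ← Module.finrank_self (A ⧸ i.asIdeal)]
  refine LinearEquiv.finrank_eq (LinearEquiv.ofBijective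
    { toFun := fun f => f 1, map_add' := fun _ _ => rfl, map_smul' := fun _ _ => rfl } ⟨?_, ?_⟩)
  · intro f g h
    ext
    exact h
  · intro a
    refine ⟨LinearMap.mulLeft A a, mul_one a⟩

/-- An element of k outside i kills the source and acts invertibly on the target. -/
theorem mult_quot_of_ne {i k : MaximalSpectrum A} (h : k ≠ i) : mult A (A ⧸ k.asIdeal) i = 0 := by
  have : Subsingleton ((A ⧸ k.asIdeal) →ₗ[A] (A ⧸ i.asIdeal)) := by
    refine subsingleton_of_forall_eq 0 fun f => ?_
    have hk : ¬ k.asIdeal ≤ i.asIdeal := fun hle =>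
      h (MaximalSpectrum.ext (k.isMaximal.eq_of_le i.isMaximal.ne_top hle))
    obtain ⟨a, ha, hai⟩ := SetLike.not_le_iff_exists.1 hk
    refine LinearMap.ext fun x => ?_
    have h1 : a • x = 0 := by
      obtain ⟨x, rfl⟩ := Ideal.Quotient.mk_surjective x
      rw [← Ideal.Quotient.mk_eq_mk, ← Submodule.Quotient.mk_smul, Submodule.Quotient.mk_eq_zero]
      exact Ideal.mul_mem_right _ _ ha
    have h2 : a • f x = 0 := by rw [← map_smul, h1, map_zero]
    rw [Algebra.smul_def] at h2
    rcases mul_eq_zero.1 h2 with h3 | h3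
    · exact absurd (Ideal.Quotient.eq_zero_iff_mem.1 h3) hai
    · exact h3
  exact Module.finrank_zero_of_subsingleton

open Classical in
theorem mult_pi [Finite A] {J : Type*} [Fintype J] (σ : J → MaximalSpectrum A)
    (i : MaximalSpectrum A) :
    mult A (∀ j, A ⧸ (σ j).asIdeal) i = Fintype.card {j // σ j = i} := by
  rw [mult, ← (LinearMap.lsum A (fun j => A ⧸ (σ j).asIdeal) (A ⧸ i.asIdeal)).finrank_eq,
    Module.finrank_pi_fintype, Fintype.card_subtype, Finset.card_filter]
  refine Finset.sum_congr rfl fun j _ => ?_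
  split_ifs with h
  · subst h
    exact mult_quot_self _
  · exact mult_quot_of_ne h

theorem exists_linearEquiv_pi_quot [IsSemisimpleRing A] [Finite V] :
    ∃ (n : ℕ) (σ : Fin n → MaximalSpectrum A),
      Nonempty (V ≃ₗ[A] ∀ j, A ⧸ (σ j).asIdeal) := by
  have : Module.Finite A V := Module.Finite.of_finite
  obtain ⟨n, S, e, hS⟩ := IsSemisimpleModule.exists_linearEquiv_fin_dfinsupp A V
  have h : ∀ j, ∃ i : MaximalSpectrum A, Nonempty (S j ≃ₗ[A] A ⧸ i.asIdeal) := by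
    intro j
    obtain ⟨I, hI, hI'⟩ := isSimpleModule_iff_quot_maximal.1 (hS j)
    exact ⟨⟨I, hI⟩, hI'⟩
  choose σ hσ using h
  exact ⟨n, σ, ⟨e.trans ((DFinsupp.linearEquivFunOnFintype).trans
    (LinearEquiv.piCongrRight fun j => (hσ j).some))⟩⟩

theorem nonempty_linearEquiv_iff_mult_eq [Finite A] [IsSemisimpleRing A] [Finite V] [Finite W] :
    Nonempty (V ≃ₗ[A] W) ↔ mult A V = mult A W := by
  classical
  refine ⟨fun ⟨e⟩ => mult_congr e, fun h => ?_⟩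
  obtain ⟨n, σ, ⟨e⟩⟩ := exists_linearEquiv_pi_quot (A := A) (V := V)
  obtain ⟨n', σ', ⟨e'⟩⟩ := exists_linearEquiv_pi_quot (A := A) (V := W)
  rw [mult_congr e, mult_congr e'] at h
  have h1 : ∀ i, Nonempty ({j // σ j = i} ≃ {j // σ' j = i}) := fun i => by
    rw [← Fintype.card_eq, ← mult_pi, ← mult_pi, h]
  -- Equal multiplicities allow simple summands of the same type to be matched bijectively.
  let τ : Fin n ≃ Fin n' := Equiv.ofFiberEquiv fun i => (h1 i).some
  have hτ : σ = σ' ∘ τ := funext fun j => (Equiv.ofFiberEquiv_map (fun i => (h1 i).some) j).symm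
  have e2 : (∀ j, A ⧸ (σ j).asIdeal) ≃ₗ[A] ∀ j, A ⧸ (σ' j).asIdeal := by
    rw [hτ]
    exact LinearEquiv.piCongrLeft A (fun j => A ⧸ (σ' j).asIdeal) τ
  exact ⟨(e.trans e2).trans e'.symm⟩

/-- The semisimple module with given multiplicities. -/
abbrev ModuleOfMult (m : MaximalSpectrum A → ℕ) : Type _ :=
  ∀ x : Σ i, Fin (m i), A ⧸ x.1.asIdeal

theorem mult_moduleOfMult [Finite A] (m : MaximalSpectrum A → ℕ) :
    mult A (ModuleOfMult m) = m := by
  classical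
  have := Fintype.ofFinite (MaximalSpectrum A)
  funext i
  rw [mult_pi (fun x : Σ i, Fin (m i) => x.1) i,
    Fintype.card_congr (Equiv.sigmaSubtype i)]
  simp

theorem mult_add_mult_of_isCompl [Finite A] [Finite V] {U U' : Submodule A V}
    (h : IsCompl U U') : mult A U + mult A U' = mult A V := by
  rw [← mult_prod]
  exact mult_congr (Submodule.prodEquivOfIsCompl U U' h)

/-- Multiplicities are additive, so complements of U and U' are isomorphic once U and U' are; the
two isomorphisms glue to an automorphism of V. -/
theorem mult_eq_iff_mem_orbit [Finite A] [IsSemisimpleRing A] [Finite V] (U U' : Submodule A V) :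
    mult A U = mult A U' ↔ U ∈ MulAction.orbit (V ≃ₗ[A] V) U' := by
  constructor
  · intro h
    obtain ⟨W, hW⟩ := exists_isCompl U
    obtain ⟨W', hW'⟩ := exists_isCompl U'
    have h' : mult A W' = mult A W := by
      have := (mult_add_mult_of_isCompl hW).trans (mult_add_mult_of_isCompl hW').symm
      rw [h] at this
      exact (add_left_cancel this).symm
    obtain ⟨e⟩ := nonempty_linearEquiv_iff_mult_eq.2 h.symm
    obtain ⟨e'⟩ := nonempty_linearEquiv_iff_mult_eq.2 h'
    let p := Submodule.prodEquivOfIsCompl U W hW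
    let p' := Submodule.prodEquivOfIsCompl U' W' hW'
    let g : V ≃ₗ[A] V := (p'.symm.trans (e.prodCongr e')).trans p
    have hg : ∀ u : U', g u = e u := fun u => by simp [g, p, p']
    refine ⟨g, ?_⟩
    change U'.map (g : V →ₗ[A] V) = U
    ext v
    constructor
    · rintro ⟨u, hu, rfl⟩
      exact (hg ⟨u, hu⟩).symm ▸ (e ⟨u, hu⟩).2
    · intro hv
      refine ⟨e.symm ⟨v, hv⟩, (e.symm ⟨v, hv⟩).2, ?_⟩
      change g _ = v
      rw [hg]
      simp
  · rintro ⟨g, rfl⟩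
    exact (mult_congr (g.submoduleMap U')).symm

theorem exists_submodule_mult_eq [Finite A] [IsSemisimpleRing A] [Finite V]
    {m : MaximalSpectrum A → ℕ} (hm : m ≤ mult A V) : ∃ U : Submodule A V, mult A U = m := by
  have h : mult A (ModuleOfMult m × ModuleOfMult (mult A V - m)) = mult A V := by
    rw [mult_prod, mult_moduleOfMult, mult_moduleOfMult, add_tsub_cancel_of_le hm]
  obtain ⟨e⟩ := nonempty_linearEquiv_iff_mult_eq.2 h
  let f := (e : _ →ₗ[A] V) ∘ₗ LinearMap.inl A (ModuleOfMult m) (ModuleOfMult (mult A V - m))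
  have hf : Function.Injective f := e.injective.comp LinearMap.inl_injective
  exact ⟨LinearMap.range f, by
    rw [← mult_congr (LinearEquiv.ofInjective f hf), mult_moduleOfMult]⟩

theorem mult_submodule_le [Finite A] [IsSemisimpleRing A] [Finite V] (U : Submodule A V) :
    mult A U ≤ mult A V := by
  obtain ⟨W, hW⟩ := exists_isCompl U
  rw [← mult_add_mult_of_isCompl hW]
  exact le_self_add

theorem mult_of_subsingleton [Subsingleton V] : mult A V = 0 := by
  funext i
  exact Module.finrank_zero_of_subsingleton

theorem subsingleton_of_mult_eq_zero [Finite A] [IsSemisimpleRing A] [Finite V]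
    (h : mult A V = 0) : Subsingleton V := by
  have : mult A V = mult A PUnit := by rw [h, mult_of_subsingleton]
  obtain ⟨e⟩ := nonempty_linearEquiv_iff_mult_eq.2 this
  exact e.injective.subsingleton

theorem card_eq_prod_mult [Finite A] [IsSemisimpleRing A] [Finite V]
    [Fintype (MaximalSpectrum A)] :
    Nat.card V = ∏ i : MaximalSpectrum A, Nat.card (A ⧸ i.asIdeal) ^ mult A V i := by
  obtain ⟨e⟩ := nonempty_linearEquiv_iff_mult_eq.2 (mult_moduleOfMult (mult A V)).symm
  rw [Nat.card_congr e.toEquiv, Nat.card_pi, Fintype.prod_sigma]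
  simp

/-- The values of the Möbius function of a chain, counted from the bottom. -/
def chainMu (k : ℕ) : ℚ := if k = 0 then 1 else if k = 1 then -1 else 0

theorem sum_range_chainMu (k : ℕ) :
    ∑ j ∈ Finset.range (k + 1), chainMu j = if k = 0 then 1 else 0 := by
  induction k with
  | zero => simp [chainMu]
  | succ k ih =>
    rw [Finset.sum_range_succ, ih]
    rcases k with _ | k <;> simp [chainMu]

/-- Orbits of submodules correspond to vectors m ≤ `mult A V`, so by orbit-stabilizer the averaged
relation says that the means, summed over all such m, give 0. This is the Möbius recursion of a
product of chains. -/
theorem meanMu_eq_prod [Finite A] [IsSemisimpleRing A] [Finite V]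
    [Fintype (MaximalSpectrum A)] :
    meanMu A V = ∏ i : MaximalSpectrum A, chainMu (mult A V i) := by
  classical
  induction hN : Nat.card V using Nat.strong_induction_on generalizing V with
  | _ N ih =>
  cases subsingleton_or_nontrivial V with
  | inl h => simp [meanMu_of_subsingleton, mult_of_subsingleton, chainMu]
  | inr h =>
    have := Fintype.ofFinite (Submodule A V)
    -- The expected product, corrected at the top vector only by the unknown discrepancy; by
    -- induction this is the mean of every submodule.
    let w : (MaximalSpectrum A → ℕ) → ℚ := fun m =>
      (∏ i, chainMu (m i)) + if m = mult A V then meanMu A V - ∏ i, chainMu (mult A V i) else 0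
    have hw : ∀ U : Submodule A V, meanMu A U = w (mult A U) := by
      intro U
      by_cases hU : mult A U = mult A V
      · obtain ⟨e⟩ := nonempty_linearEquiv_iff_mult_eq.2 hU
        simp [w, hU, meanMu_congr e]
      · simp only [w, if_neg hU, add_zero]
        refine ih (Nat.card U) ?_ rfl
        rw [← hN]
        have hlt : (U : Set V) ⊂ Set.univ := by
          refine Set.ssubset_univ_iff.2 fun h => hU ?_
          have hU' : U = ⊤ := SetLike.coe_injective h
          rw [hU', mult_congr Submodule.topEquiv]
        have := Set.ncard_lt_ncard hlt
        rwa [Set.ncard_univ] at this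
    have himage : Finset.univ.image (fun U : Submodule A V => mult A U) =
        Fintype.piFinset fun i => Finset.range (mult A V i + 1) := by
      ext m
      simp only [Finset.mem_image, Finset.mem_univ, true_and, Fintype.mem_piFinset,
        Finset.mem_range, Nat.lt_succ_iff]
      constructor
      · rintro ⟨U, rfl⟩
        exact mult_submodule_le U
      · intro hm
        exact exists_submodule_mult_eq hm
    have key := sum_card_stabilizer_mul (G := V ≃ₗ[A] V) (fun U : Submodule A V => mult A U)
      mult_eq_iff_mem_orbit w
    rw [Finset.sum_congr rfl fun U _ => by rw [← hw U],
      sum_card_stabilizer_mul_meanMu fun U => exists_isCompl U, himage] at key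
    have hG : (Nat.card (V ≃ₗ[A] V) : ℚ) ≠ 0 := Nat.cast_ne_zero.2 Nat.card_pos.ne'
    have key := (mul_eq_zero.1 key.symm).resolve_left hG
    have hne : ∃ i, mult A V i ≠ 0 := by
      by_contra! h0
      have := subsingleton_of_mult_eq_zero (funext h0)
      exact not_subsingleton V this
    obtain ⟨i, hi⟩ := hne
    -- The sum of products factors over i, and a factor with nonzero multiplicity vanishes; what
    -- remains is the discrepancy.
    rw [Finset.sum_add_distrib, ← Finset.prod_univ_sum _ fun _ j => chainMu j,
      Finset.prod_eq_zero (Finset.mem_univ i) (by rw [sum_range_chainMu, if_neg hi]),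
      Finset.sum_ite_eq', if_pos (by simp), zero_add] at key
    exact sub_eq_zero.1 key

end Mult

/-! ### Counting points of the group algebra over finite fields. -/

section Points

open Polynomial

variable {F A L : Type*} [Field F] [CommRing A] [Algebra F A] [Field L] [Algebra F L]

/-- An algebra homomorphism to a field is a homomorphism from a residue field. -/
theorem card_algHom_eq_sum [Finite F] [Finite A] [Finite L] [Fintype (MaximalSpectrum A)] :
    Nat.card (A →ₐ[F] L) = ∑ i : MaximalSpectrum A,
      if Module.finrank F (A ⧸ i.asIdeal) ∣ Module.finrank F L
        then Module.finrank F (A ⧸ i.asIdeal) else 0 := by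
  classical
  let f : (Σ i : MaximalSpectrum A, (A ⧸ i.asIdeal) →ₐ[F] L) → (A →ₐ[F] L) := fun x =>
    x.2.comp (Ideal.Quotient.mkₐ F x.1.asIdeal)
  have hker : ∀ x, RingHom.ker (f x) = x.1.asIdeal := by
    intro x
    ext a
    rw [RingHom.mem_ker]
    change x.2 (Ideal.Quotient.mk _ a) = 0 ↔ _
    rw [map_eq_zero_iff x.2 x.2.toRingHom.injective, Ideal.Quotient.eq_zero_iff_mem]
  have hf : Function.Bijective f := by
    constructor
    · rintro ⟨i, φ⟩ ⟨k, ψ⟩ h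
      have hik : i = k := MaximalSpectrum.ext (by
        rw [← hker ⟨i, φ⟩, ← hker ⟨k, ψ⟩, h])
      subst hik
      congr 1
      refine AlgHom.ext fun x => ?_
      obtain ⟨x, rfl⟩ := Ideal.Quotient.mk_surjective x
      exact DFunLike.congr_fun h x
    · intro φ
      have hp : (RingHom.ker φ).IsPrime := RingHom.ker_isPrime φ
      have hm : (RingHom.ker φ).IsMaximal := IsArtinianRing.isMaximal_of_isPrime _
      exact ⟨⟨⟨RingHom.ker φ, hm⟩, Ideal.Quotient.liftₐ _ φ fun a ha => ha⟩,
        AlgHom.ext fun a => rfl⟩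
  have hfin : ∀ i : MaximalSpectrum A, Finite ((A ⧸ i.asIdeal) →ₐ[F] L) := fun i =>
    DFunLike.finite _
  rw [← Nat.card_congr (Equiv.ofBijective f hf), Nat.card_sigma]
  -- A residue field of degree d has d embeddings into L if d divides [L : F], and none otherwise.
  refine Finset.sum_congr rfl fun i _ => ?_
  split_ifs with h
  · exact FiniteField.natCard_algHom_of_finrank_dvd h
  · rw [← FiniteField.nonempty_algHom_iff_finrank_dvd, not_nonempty_iff] at h
    exact Nat.card_of_isEmpty

theorem card_zmod_hom_units [Finite L] (M : ℕ) [NeZero M] :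
    Nat.card (Multiplicative (ZMod M) →* L) = (Nat.card L - 1).gcd M := by
  have e0 : (Multiplicative (ZMod M) →* L) ≃ (Multiplicative (ZMod M) →* Lˣ) :=
    { toFun := fun f => f.toHomUnits
      invFun := fun f => (Units.coeHom L).comp f
      left_inv := fun f => rfl
      right_inv := fun f => MonoidHom.ext fun x => Units.ext rfl }
  obtain ⟨e⟩ := IsCyclic.monoidHom_mulEquiv_rootsOfUnity (Multiplicative (ZMod M)) Lˣ
  have h1 : Nat.card (Multiplicative (ZMod M)) = M := Nat.card_zmod M
  have h2 : rootsOfUnity M L = (powMonoidHom M : Lˣ →* Lˣ).ker := rfl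
  rw [Nat.card_congr e0, Nat.card_congr e.toEquiv, h1,
    Nat.card_congr (rootsOfUnityUnitsMulEquiv L M).toEquiv, h2, IsCyclic.card_powMonoidHom_ker,
    Nat.card_units]

/-- A point is a t-tuple of M-th roots of unity in the cyclic group of units of L. -/
theorem card_monoidAlgebra_algHom [Finite L] (t M : ℕ) [NeZero M] :
    Nat.card (MonoidAlgebra F (Fin t → Multiplicative (ZMod M)) →ₐ[F] L) =
      (Nat.card L - 1).gcd M ^ t := by
  rw [← Nat.card_congr (MonoidAlgebra.lift F L (Fin t → Multiplicative (ZMod M))),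
    Nat.card_congr (Pi.monoidHomMulEquiv _ _).toEquiv, Nat.card_pi, Finset.prod_const,
    card_zmod_hom_units, Finset.card_univ, Fintype.card_fin]

end Points

/-! ### Congruences for products of factors 1 - X^d modulo powers of 2. -/

section Product

open Polynomial

/-- (1 - Y)^2 ≡ 1 - Y^2 modulo 2, and each further squaring of a congruence gains a factor 2. -/
theorem two_pow_dvd_one_sub_X_pow_sub (j k : ℕ) :
    ((2 ^ (k + 1) : ℕ) : ℤ[X]) ∣
      (1 - X ^ 2 ^ j) ^ 2 ^ (k + 1) - (1 - X ^ 2 ^ (j + 1)) ^ 2 ^ k := by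
  have h : ((2 : ℕ) : ℤ[X]) ∣ (1 - X ^ 2 ^ j) ^ 2 - (1 - X ^ 2 ^ (j + 1)) :=
    ⟨(X ^ 2 ^ j) ^ 2 - X ^ 2 ^ j, by push_cast; ring⟩
  have := dvd_sub_pow_of_dvd_sub h k
  rw [← pow_mul, ← pow_succ'] at this
  exact_mod_cast this

/-- Induction on j. For j = 0 there are exactly 2^(e 0) factors 1 - X. To pass to j + 1, half the
exponent of 1 - X^(2^j) becomes an exponent of 1 - X^(2^(j+1)), at the cost of a congruence modulo
2^(e j - j), which `he` makes fine enough; the new factors of degree 2^(j+1) complete the exponent.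
-/
theorem two_pow_dvd_prod_sub {I : Type*} [Fintype I] (d : I → ℕ) (e : ℕ → ℕ) (j0 : ℕ)
    (he0 : 1 ≤ e 0) (he : ∀ j ≤ j0, e 0 + j ≤ e j)
    (hd : ∀ j ≤ j0, ∑ i, (if d i ∣ 2 ^ j then d i else 0) = 2 ^ e j) (j : ℕ) (hj : j ≤ j0) :
    ((2 ^ e 0 : ℕ) : ℤ[X]) ∣ ∏ i with d i ∣ 2 ^ j, (1 - X ^ d i : ℤ[X]) -
      (1 - X ^ 2 ^ j) ^ 2 ^ (e j - j) := by
  classical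
  induction j with
  | zero =>
    have h1 : ∀ i ∈ Finset.univ.filter (fun i => d i ∣ 2 ^ 0), d i = 1 := fun i hi => by
      simpa using (Finset.mem_filter.1 hi).2
    have h2 : (Finset.univ.filter (fun i => d i ∣ 2 ^ 0)).card = 2 ^ e 0 := by
      rw [← hd 0 hj, ← Finset.sum_filter, Finset.sum_congr rfl h1]
      simp
    rw [Finset.prod_congr rfl fun i hi => by rw [h1 i hi], Finset.prod_const, h2]
    simp
  | succ j ih =>
    have ih := ih (by omega)
    have hej := he j (by omega)
    have hej' := he (j + 1) hj
    let S := Finset.univ.filter (fun i => d i = 2 ^ (j + 1))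
    have hsplit : Finset.univ.filter (fun i => d i ∣ 2 ^ (j + 1)) =
        Finset.univ.filter (fun i => d i ∣ 2 ^ j) ∪ S := by
      ext i
      simp only [S, Finset.mem_union, Finset.mem_filter, Finset.mem_univ, true_and]
      constructor
      · intro h
        obtain ⟨k, hk, hk'⟩ := (Nat.dvd_prime_pow Nat.prime_two).1 h
        rcases hk.lt_or_eq with h1 | h1
        · exact Or.inl (hk' ▸ pow_dvd_pow 2 (by omega))
        · exact Or.inr (by rw [hk', h1])
      · rintro (h | h)
        · exact h.trans (pow_dvd_pow 2 (by omega))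
        · rw [h]
    have hdisj : Disjoint (Finset.univ.filter (fun i => d i ∣ 2 ^ j)) S := by
      refine Finset.disjoint_left.2 fun i hi hi' => ?_
      have h1 := (Finset.mem_filter.1 hi).2
      rw [(Finset.mem_filter.1 hi').2, Nat.pow_dvd_pow_iff_le_right (by norm_num)] at h1
      omega
    have hS : ∀ i ∈ S, d i = 2 ^ (j + 1) := fun i hi => (Finset.mem_filter.1 hi).2
    have hcard : 2 ^ e j + S.card * 2 ^ (j + 1) = 2 ^ e (j + 1) := by
      rw [← hd j (by omega), ← hd (j + 1) hj, ← Finset.sum_filter, ← Finset.sum_filter, hsplit,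
        Finset.sum_union hdisj, Finset.sum_congr rfl hS]
      simp
    -- This is `hcard` divided by 2^(j+1).
    have hexp : 2 ^ (e j - j - 1) + S.card = 2 ^ (e (j + 1) - (j + 1)) := by
      refine Nat.eq_of_mul_eq_mul_right (pow_pos two_pos (j + 1)) ?_
      rw [add_mul, ← pow_add, ← pow_add, show e j - j - 1 + (j + 1) = e j by omega, hcard,
        show e (j + 1) - (j + 1) + (j + 1) = e (j + 1) by omega]
    have hprod : ∏ i ∈ S, (1 - X ^ d i : ℤ[X]) = (1 - X ^ 2 ^ (j + 1)) ^ S.card :=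
      Finset.prod_eq_pow_card fun i hi => by rw [hS i hi]
    rw [hsplit, Finset.prod_union hdisj, hprod, ← hexp,
      pow_add (1 - X ^ 2 ^ (j + 1) : ℤ[X]), ← sub_mul]
    refine Dvd.dvd.mul_right ?_ _
    have h2 := two_pow_dvd_one_sub_X_pow_sub j (e j - j - 1)
    rw [show e j - j - 1 + 1 = e j - j by omega] at h2
    have h3 : ((2 ^ e 0 : ℕ) : ℤ[X]) ∣ ((2 ^ (e j - j) : ℕ) : ℤ[X]) :=
      Nat.cast_dvd_cast (pow_dvd_pow 2 (by omega))
    have h4 := dvd_add ih (h3.trans h2)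
    rwa [sub_add_sub_cancel] at h4

/-- A power of 1 - X^(2^j0) has no terms in degrees strictly between 0 and 2^j0. -/
theorem two_pow_dvd_coeff_prod {I : Type*} [Fintype I] (d : I → ℕ) (e : ℕ → ℕ) (j0 n : ℕ)
    (he0 : 1 ≤ e 0) (he : ∀ j ≤ j0, e 0 + j ≤ e j)
    (hd : ∀ j ≤ j0, ∑ i, (if d i ∣ 2 ^ j then d i else 0) = 2 ^ e j)
    (hall : ∀ i, d i ∣ 2 ^ j0) (hn : 0 < n) (hn' : n < 2 ^ j0) :
    (2 ^ e 0 : ℤ) ∣ (∏ i, (1 - X ^ d i : ℤ[X])).coeff n := by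
  have h := two_pow_dvd_prod_sub d e j0 he0 he hd j0 le_rfl
  rw [Finset.filter_true_of_mem fun i _ => hall i] at h
  have h1 : ((1 - X ^ 2 ^ j0 : ℤ[X]) ^ 2 ^ (e j0 - j0)).coeff n = 0 := by
    have h2 : (X ^ 2 ^ j0 : ℤ[X]) ∣ (1 - X ^ 2 ^ j0 : ℤ[X]) ^ 2 ^ (e j0 - j0) - 1 ^ 2 ^ (e j0 - j0) :=
      Dvd.dvd.trans ⟨-1, by ring⟩ (sub_dvd_pow_sub_pow _ _ _)
    have h3 := (X_pow_dvd_iff.1 h2) n hn'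
    rwa [one_pow, coeff_sub, coeff_one, if_neg hn.ne', sub_zero] at h3
  have h2 : (C (2 ^ e 0 : ℤ)) ∣ ∏ i, (1 - X ^ d i : ℤ[X]) - (1 - X ^ 2 ^ j0) ^ 2 ^ (e j0 - j0) := by
    simpa using h
  have h3 := (C_dvd_iff_dvd_coeff _ _).1 h2 n
  rwa [coeff_sub, h1, sub_zero] at h3

end Product

/-! ### Representations as modules; homomorphisms from ℤ × Q as pairs of a module and an
automorphism. -/

section RepModule

open LinearMap (GeneralLinearGroup)

variable {F V Q : Type*} [Field F] [AddCommGroup V] [Module F V] [CommGroup Q]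

/-- The vector space `V` as a module over the group algebra. -/
def RepModule (_ : Q →* GeneralLinearGroup F V) : Type _ := V

variable (Y Y' : Q →* GeneralLinearGroup F V)

instance : AddCommGroup (RepModule Y) := inferInstanceAs (AddCommGroup V)

instance : Module F (RepModule Y) := inferInstanceAs (Module F V)

instance [Finite V] : Finite (RepModule Y) := inferInstanceAs (Finite V)

instance [Nontrivial V] : Nontrivial (RepModule Y) := inferInstanceAs (Nontrivial V)

/-- The action of the group algebra. -/
noncomputable def repAlgHom : MonoidAlgebra F Q →ₐ[F] (RepModule Y →ₗ[F] RepModule Y) :=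
  MonoidAlgebra.lift F (V →ₗ[F] V) Q ((Units.coeHom (V →ₗ[F] V)).comp Y)

noncomputable instance : Module (MonoidAlgebra F Q) (RepModule Y) :=
  Module.compHom (RepModule Y) (repAlgHom Y).toRingHom

/-- The identity map to the module attached to a representation. -/
def toRepModule : V ≃ₗ[F] RepModule Y := LinearEquiv.refl F V

theorem repModule_smul_def (a : MonoidAlgebra F Q) (v : RepModule Y) :
    a • v = repAlgHom Y a v := rfl

theorem single_smul_repModule (q : Q) (v : V) :
    (MonoidAlgebra.single q (1 : F)) • toRepModule Y v = toRepModule Y ((Y q : V →ₗ[F] V) v) := by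
  change (MonoidAlgebra.lift F (V →ₗ[F] V) Q ((Units.coeHom (V →ₗ[F] V)).comp Y)
    (MonoidAlgebra.single q 1)) v = (Y q : V →ₗ[F] V) v
  rw [MonoidAlgebra.lift_single, one_smul]
  rfl

instance : IsScalarTower F (MonoidAlgebra F Q) (RepModule Y) where
  smul_assoc c a v := by
    rw [repModule_smul_def, repModule_smul_def, map_smul]
    rfl

variable {M : Type*} [AddCommGroup M] [Module F M] [Module (MonoidAlgebra F Q) M]
  [IsScalarTower F (MonoidAlgebra F Q) M]

/-- An equivariant isomorphism is linear over the group algebra. -/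
noncomputable def repModuleEquiv (f : V ≃ₗ[F] M)
    (hf : ∀ q v, f ((Y q : V →ₗ[F] V) v) = MonoidAlgebra.single q (1 : F) • f v) :
    RepModule Y ≃ₗ[MonoidAlgebra F Q] M :=
  { (toRepModule Y).symm.trans f with
    map_smul' := fun a v => by
      change f ((toRepModule Y).symm (a • v)) = a • f ((toRepModule Y).symm v)
      induction a using MonoidAlgebra.induction_on with
      | of q =>
        rw [MonoidAlgebra.of_apply, ← hf]
        congr 1
        exact single_smul_repModule Y q v
      | add a b ha hb => rw [add_smul, add_smul, map_add, map_add, ha, hb]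
      | smul c a ha => rw [smul_assoc, smul_assoc, map_smul, map_smul, ha] }

/-- Conjugation of representations. -/
instance conjHomAction {G Q : Type*} [Group G] [Monoid Q] : MulAction G (Q →* G) where
  smul g Y := (MulAut.conj g).toMonoidHom.comp Y
  one_smul Y := by
    ext q
    change 1 * Y q * 1⁻¹ = Y q
    simp
  mul_smul g h Y := by
    ext q
    change g * h * Y q * (g * h)⁻¹ = g * (h * Y q * h⁻¹) * g⁻¹
    group

theorem conjHomAction_apply {G Q : Type*} [Group G] [Monoid Q] (g : G) (Y : Q →* G) (q : Q) :
    (g • Y) q = g * Y q * g⁻¹ := rfl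

theorem smul_hom_eq_iff {G Q : Type*} [Group G] [Monoid Q] {g : G} {Y Y' : Q →* G} :
    g • Y = Y' ↔ ∀ q, g * Y q = Y' q * g := by
  rw [MonoidHom.ext_iff]
  refine forall_congr' fun q => ?_
  rw [conjHomAction_apply, mul_inv_eq_iff_eq_mul]

/-- The elements conjugating `Y` to `Y'` are the isomorphisms of the attached modules. -/
noncomputable def conjEquiv :
    {g : GeneralLinearGroup F V // g • Y = Y'} ≃
      (RepModule Y ≃ₗ[MonoidAlgebra F Q] RepModule Y') where
  toFun g := repModuleEquiv Y
    ((LinearMap.GeneralLinearGroup.generalLinearEquiv F V g.1).trans (toRepModule Y')) (by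
      intro q v
      have := smul_hom_eq_iff.1 g.2 q
      have := LinearMap.congr_fun (congrArg Units.val this) v
      change toRepModule Y' ((g.1 : V →ₗ[F] V) ((Y q : V →ₗ[F] V) v)) =
        MonoidAlgebra.single q (1 : F) • toRepModule Y' ((g.1 : V →ₗ[F] V) v)
      rw [single_smul_repModule]
      exact congrArg _ this)
  invFun e := ⟨(LinearMap.GeneralLinearGroup.generalLinearEquiv F V).symm
      (((toRepModule Y).trans (e.restrictScalars F)).trans (toRepModule Y').symm),
    smul_hom_eq_iff.2 fun q => Units.ext (LinearMap.ext fun v => by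
      change (toRepModule Y').symm (e (toRepModule Y ((Y q : V →ₗ[F] V) v))) =
        (Y' q : V →ₗ[F] V) ((toRepModule Y').symm (e (toRepModule Y v)))
      rw [← single_smul_repModule, map_smul]
      exact single_smul_repModule Y' q _)⟩
  left_inv g := Subtype.ext (Units.ext (LinearMap.ext fun v => rfl))
  right_inv e := LinearEquiv.ext fun v => rfl

theorem mem_orbit_iff_nonempty :
    Y ∈ MulAction.orbit (GeneralLinearGroup F V) Y' ↔
      Nonempty (RepModule Y' ≃ₗ[MonoidAlgebra F Q] RepModule Y) :=
  ⟨fun ⟨g, hg⟩ => ⟨conjEquiv Y' Y ⟨g, hg⟩⟩, fun ⟨e⟩ => ⟨_, ((conjEquiv Y' Y).symm e).2⟩⟩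

theorem sigma_centralizer_ext {G Q : Type*} [Group G] [CommGroup Q]
    {x y : Σ Y : Q →* G, {g : G // g • Y = Y}} (h1 : x.1 = y.1) (h2 : x.2.1 = y.2.1) : x = y := by
  obtain ⟨Y, g, hg⟩ := x
  obtain ⟨Y', g', hg'⟩ := y
  obtain rfl : Y = Y' := h1
  obtain rfl : g = g' := h2
  rfl

/-- A homomorphism from `ℤ × Q` is a homomorphism from `Q` and an element centralizing it. -/
def homProdEquiv (G Q : Type*) [Group G] [CommGroup Q] :
    (Multiplicative ℤ × Q →* G) ≃ Σ Y : Q →* G, {g : G // g • Y = Y} where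
  toFun X := ⟨X.comp (MonoidHom.inr _ _), X (Multiplicative.ofAdd 1, 1),
    smul_hom_eq_iff.2 fun q => by
      change X _ * X (1, q) = X (1, q) * X _
      rw [← map_mul, ← map_mul, mul_comm]⟩
  invFun x := MonoidHom.noncommCoprod (zpowersHom G x.2.1) x.1 fun k q => by
    rw [zpowersHom_apply]
    exact Commute.zpow_left (smul_hom_eq_iff.1 x.2.2 q) _
  left_inv X := by
    refine MonoidHom.ext fun ⟨k, q⟩ => ?_
    rw [MonoidHom.noncommCoprod_apply, zpowersHom_apply, ← map_zpow]
    change X _ * X (1, q) = _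
    rw [← map_mul]
    congr 1
    refine Prod.ext ?_ (by simp)
    simp [← ofAdd_zsmul]
  right_inv x := sigma_centralizer_ext (MonoidHom.ext fun q => by simp)
    (by simp [zpowersHom_apply])

theorem homProdEquiv_symm_apply {G Q : Type*} [Group G] [CommGroup Q]
    (x : Σ Y : Q →* G, {g : G // g • Y = Y}) (h : Multiplicative ℤ × Q) :
    (homProdEquiv G Q).symm x h = x.2.1 ^ (Multiplicative.toAdd h.1) * x.1 h.2 := rfl

/-- The subgroup of the general linear group fixing a subspace. -/
def subspaceStabilizer (U : Submodule F V) : Subgroup (GeneralLinearGroup F V) where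
  carrier := {g | U.map (g : V →ₗ[F] V) = U}
  one_mem' := Submodule.map_id U
  mul_mem' {g h} hg hh := by
    change U.map ((g : V →ₗ[F] V) ∘ₗ (h : V →ₗ[F] V)) = U
    rw [Submodule.map_comp, show U.map (h : V →ₗ[F] V) = U from hh]
    exact hg
  inv_mem' {g} hg := by
    have hg : U.map (g : V →ₗ[F] V) = U := hg
    change U.map ((g⁻¹ : GeneralLinearGroup F V) : V →ₗ[F] V) = U
    conv_lhs => rw [← hg]
    rw [← Submodule.map_comp]
    have : ((g⁻¹ : GeneralLinearGroup F V) : V →ₗ[F] V) ∘ₗ (g : V →ₗ[F] V) = LinearMap.id :=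
      g.inv_mul
    rw [this, Submodule.map_id]

theorem invariant_iff (x : Σ Y : Q →* GeneralLinearGroup F V, {g // g • Y = Y})
    (U : Submodule F V) :
    (∀ h, U.map ((homProdEquiv _ Q).symm x h : V →ₗ[F] V) = U) ↔
      U.map (x.2.1 : V →ₗ[F] V) = U ∧ ∀ q, U.map (x.1 q : V →ₗ[F] V) = U := by
  constructor
  · intro h
    refine ⟨?_, fun q => ?_⟩
    · have := h (Multiplicative.ofAdd 1, 1)
      simpa [homProdEquiv_symm_apply] using this
    · have := h (1, q)
      simpa [homProdEquiv_symm_apply] using this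
  · rintro ⟨h1, h2⟩ h
    rw [homProdEquiv_symm_apply]
    have h1 : x.2.1 ∈ subspaceStabilizer U := h1
    have h2 : x.1 h.2 ∈ subspaceStabilizer U := h2 h.2
    exact mul_mem (zpow_mem h1 _) h2

/-- An invariant subspace as a submodule. -/
def invariantSubmodule (U : Submodule F V) (hU : ∀ q, U.map (Y q : V →ₗ[F] V) = U) :
    Submodule (MonoidAlgebra F Q) (RepModule Y) where
  carrier := {v | (toRepModule Y).symm v ∈ U}
  add_mem' := U.add_mem
  zero_mem' := U.zero_mem
  smul_mem' a v hv := by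
    change (toRepModule Y).symm (a • v) ∈ U
    induction a using MonoidAlgebra.induction_on with
    | of q =>
      rw [← hU q]
      exact ⟨_, hv, (single_smul_repModule Y q v).symm⟩
    | add a b ha hb => rw [add_smul, map_add]; exact U.add_mem ha hb
    | smul c a ha => rw [smul_assoc, map_smul]; exact U.smul_mem c ha

/-- The subspaces invariant under `ℤ × Q` are the submodules fixed by an automorphism. -/
noncomputable def fixedSubspaceOrderIso [Finite V]
    (x : Σ Y : Q →* GeneralLinearGroup F V, {g // g • Y = Y}) :
    FixedProperSubspace ((homProdEquiv _ Q).symm x) ≃o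
      FixedProper (conjEquiv x.1 x.1 x.2) where
  toFun U := ⟨invariantSubmodule x.1 U.1 ((invariant_iff x U.1).1 U.2.2).2, by
    refine ⟨⟨fun h => U.2.1.1 ?_, fun h => U.2.1.2 ?_⟩, ?_⟩
    · ext v
      exact SetLike.ext_iff.1 h (toRepModule x.1 v)
    · ext v
      exact SetLike.ext_iff.1 h (toRepModule x.1 v)
    · ext v
      exact SetLike.ext_iff.1 ((invariant_iff x U.1).1 U.2.2).1 v⟩
  invFun W := ⟨(W.1.restrictScalars F).comap (toRepModule x.1 : V →ₗ[F] RepModule x.1), by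
    refine ⟨⟨fun h => W.2.1.1 ?_, fun h => W.2.1.2 ?_⟩, (invariant_iff x _).2 ⟨?_, fun q => ?_⟩⟩
    · ext v
      exact SetLike.ext_iff.1 h ((toRepModule x.1).symm v)
    · ext v
      exact SetLike.ext_iff.1 h ((toRepModule x.1).symm v)
    · ext v
      exact SetLike.ext_iff.1 W.2.2 v
    · have hle : ∀ q, ((W.1.restrictScalars F).comap
          (toRepModule x.1 : V →ₗ[F] RepModule x.1)).map (x.1 q : V →ₗ[F] V) ≤
          (W.1.restrictScalars F).comap (toRepModule x.1 : V →ₗ[F] RepModule x.1) := by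
        rintro q _ ⟨v, hv, rfl⟩
        change toRepModule x.1 ((x.1 q : V →ₗ[F] V) v) ∈ W.1
        rw [← single_smul_repModule]
        exact W.1.smul_mem _ hv
      -- A submodule is only mapped into itself; equality comes from applying q⁻¹ as well.
      refine le_antisymm (hle q) fun v hv => ?_
      refine ⟨(x.1 q⁻¹ : V →ₗ[F] V) v, hle q⁻¹ ⟨v, hv, rfl⟩, ?_⟩
      change ((x.1 q * x.1 q⁻¹ : GeneralLinearGroup F V) : V →ₗ[F] V) v = v
      rw [← map_mul, mul_inv_cancel, map_one]
      rfl⟩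
  left_inv U := rfl
  right_inv W := rfl
  map_rel_iff' := Iff.rfl

end RepModule

/-! ### The Euler characteristic as a coefficient of ∏ (1 - X^d_i). -/

section Sum

open LinearMap (GeneralLinearGroup)
open Polynomial

variable {F V Q : Type*} [Field F] [AddCommGroup V] [Module F V] [CommGroup Q]

instance finite_monoidAlgebra [Finite F] [Finite Q] : Finite (MonoidAlgebra F Q) :=
  Module.finite_of_finite F

/-- Transport of structure along f; the operators are invertible because Q is a group. -/
theorem nonempty_repModule_equiv {M : Type*} [AddCommGroup M] [Module F M]
    [Module (MonoidAlgebra F Q) M] [IsScalarTower F (MonoidAlgebra F Q) M] (f : V ≃ₗ[F] M) :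
    ∃ Y : Q →* GeneralLinearGroup F V, Nonempty (RepModule Y ≃ₗ[MonoidAlgebra F Q] M) := by
  let ρ : Q →* (V →ₗ[F] V) :=
    { toFun := fun q => (f.symm : M →ₗ[F] V) ∘ₗ
        (Algebra.lsmul F F M (MonoidAlgebra.single q (1 : F))) ∘ₗ (f : V →ₗ[F] M)
      map_one' := by
        ext v
        simp [← MonoidAlgebra.one_def]
      map_mul' := fun q q' => by
        ext v
        change f.symm (MonoidAlgebra.single (q * q') (1 : F) • f v) =
          f.symm (MonoidAlgebra.single q (1 : F) •
            f (f.symm (MonoidAlgebra.single q' (1 : F) • f v)))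
        rw [LinearEquiv.apply_symm_apply, ← mul_smul, MonoidAlgebra.single_mul_single, mul_one] }
  refine ⟨ρ.toHomUnits, ⟨repModuleEquiv _ f fun q v => ?_⟩⟩
  change f (f.symm (MonoidAlgebra.single q (1 : F) • f v)) = _
  simp

theorem mult_repModule_eq_iff [Finite F] [Finite V] [Finite Q] [NeZero (Nat.card Q : F)]
    (Y Y' : Q →* GeneralLinearGroup F V) :
    mult (MonoidAlgebra F Q) (RepModule Y) = mult (MonoidAlgebra F Q) (RepModule Y') ↔
      Y ∈ MulAction.orbit (GeneralLinearGroup F V) Y' := by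
  rw [mem_orbit_iff_nonempty, nonempty_linearEquiv_iff_mult_eq, eq_comm]

/-- The only constraint is the dimension, which is read off from cardinalities as an exponent of
|F|. -/
theorem exists_mult_repModule_eq_iff [Finite F] [Finite V] [Finite Q] [NeZero (Nat.card Q : F)]
    [Fintype (MaximalSpectrum (MonoidAlgebra F Q))]
    (m : MaximalSpectrum (MonoidAlgebra F Q) → ℕ) :
    (∃ Y : Q →* GeneralLinearGroup F V, mult (MonoidAlgebra F Q) (RepModule Y) = m) ↔
      ∑ i, Module.finrank F (MonoidAlgebra F Q ⧸ i.asIdeal) * m i = Module.finrank F V := by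
  have hq : 1 < Nat.card F := Finite.one_lt_card
  have hcard : ∀ i : MaximalSpectrum (MonoidAlgebra F Q),
      Nat.card (MonoidAlgebra F Q ⧸ i.asIdeal) =
        Nat.card F ^ Module.finrank F (MonoidAlgebra F Q ⧸ i.asIdeal) := fun i =>
    Module.natCard_eq_pow_finrank
  have hprod : ∏ i : MaximalSpectrum (MonoidAlgebra F Q),
      Nat.card (MonoidAlgebra F Q ⧸ i.asIdeal) ^ m i =
        Nat.card F ^ ∑ i, Module.finrank F (MonoidAlgebra F Q ⧸ i.asIdeal) * m i := by
    rw [← Finset.prod_pow_eq_pow_sum]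
    exact Finset.prod_congr rfl fun i _ => by rw [hcard, pow_mul]
  have hV : Nat.card V = Nat.card F ^ Module.finrank F V := Module.natCard_eq_pow_finrank
  constructor
  · rintro ⟨Y, rfl⟩
    have h := card_eq_prod_mult (A := MonoidAlgebra F Q) (V := RepModule Y)
    rw [hprod, show Nat.card (RepModule Y) = Nat.card V from rfl, hV] at h
    exact (Nat.pow_right_injective hq h).symm
  · intro h
    have hM : Nat.card (ModuleOfMult m) = Nat.card V := by
      rw [card_eq_prod_mult (A := MonoidAlgebra F Q), mult_moduleOfMult, hprod, h, hV]
    have hfr : Module.finrank F V = Module.finrank F (ModuleOfMult m) := by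
      refine Nat.pow_right_injective hq ?_
      change Nat.card F ^ _ = Nat.card F ^ _
      rw [← hV, ← hM]
      exact Module.natCard_eq_pow_finrank
    obtain ⟨Y, ⟨e⟩⟩ := nonempty_repModule_equiv (Q := Q) (LinearEquiv.ofFinrankEq V _ hfr)
    exact ⟨Y, by rw [mult_congr e, mult_moduleOfMult]⟩

/-- Each factor is the generating function of `chainMu`, which vanishes from 2 on. -/
theorem prod_one_sub_X_pow {I : Type*} [Fintype I] [DecidableEq I] (d : I → ℕ) :
    ∏ i, (1 - X ^ d i : ℚ[X]) = ∑ m ∈ Fintype.piFinset fun _ : I => Finset.range 2,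
      C (∏ i, chainMu (m i)) * X ^ ∑ i, d i * m i := by
  have h : ∀ i, (1 - X ^ d i : ℚ[X]) =
      ∑ j ∈ Finset.range 2, C (chainMu j) * X ^ (d i * j) := fun i => by
    simp [Finset.sum_range_succ, chainMu, sub_eq_add_neg]
  rw [Finset.prod_congr rfl fun i _ => h i, Finset.prod_univ_sum]
  refine Finset.sum_congr rfl fun m _ => ?_
  rw [Finset.prod_mul_distrib, Finset.prod_pow_eq_pow_sum, map_prod]

theorem sum_reducedEulerChar_hom [Finite F] [Finite V] [Nontrivial V] [Finite Q]
    [NeZero (Nat.card Q : F)] [Fintype (MaximalSpectrum (MonoidAlgebra F Q))]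
    [Fintype (Multiplicative ℤ × Q →* GeneralLinearGroup F V)] :
    ∑ X : Multiplicative ℤ × Q →* GeneralLinearGroup F V,
      (reducedEulerChar (FixedProperSubspace X) : ℚ) =
    Nat.card (GeneralLinearGroup F V) *
      ((∏ i : MaximalSpectrum (MonoidAlgebra F Q),
        (1 - X ^ Module.finrank F (MonoidAlgebra F Q ⧸ i.asIdeal) : ℤ[X])).coeff
          (Module.finrank F V) : ℤ) := by
  classical
  have : Finite (Q →* GeneralLinearGroup F V) := DFunLike.finite _
  have := Fintype.ofFinite (Q →* GeneralLinearGroup F V)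
  have := Fintype.ofFinite (GeneralLinearGroup F V)
  rw [← Fintype.sum_equiv (homProdEquiv (GeneralLinearGroup F V) Q).symm
    (fun x => (autMu (conjEquiv x.1 x.1 x.2) : ℚ)) _ fun x => by
      rw [autMu_of_nontrivial, reducedEulerChar_congr (fixedSubspaceOrderIso x)],
    Fintype.sum_sigma]
  have h1 : ∀ Y : Q →* GeneralLinearGroup F V,
      ∑ g : {g : GeneralLinearGroup F V // g • Y = Y}, (autMu (conjEquiv Y Y g) : ℚ) =
        Nat.card (MulAction.stabilizer (GeneralLinearGroup F V) Y) *
          ∏ i, chainMu (mult (MonoidAlgebra F Q) (RepModule Y) i) := by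
    intro Y
    have := Fintype.ofFinite (RepModule Y ≃ₗ[MonoidAlgebra F Q] RepModule Y)
    rw [← meanMu_eq_prod, show Nat.card (MulAction.stabilizer (GeneralLinearGroup F V) Y) =
      Nat.card (RepModule Y ≃ₗ[MonoidAlgebra F Q] RepModule Y) from
        Nat.card_congr (conjEquiv Y Y), card_mul_meanMu]
    exact Fintype.sum_equiv (conjEquiv Y Y) _ _ fun g => rfl
  rw [Finset.sum_congr rfl fun Y _ => h1 Y]
  rw [sum_card_stabilizer_mul (fun Y : Q →* GeneralLinearGroup F V =>
    mult (MonoidAlgebra F Q) (RepModule Y)) mult_repModule_eq_iff fun m => ∏ i, chainMu (m i)]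
  congr 1
  have h2 : (((∏ i : MaximalSpectrum (MonoidAlgebra F Q),
        (1 - X ^ Module.finrank F (MonoidAlgebra F Q ⧸ i.asIdeal) : ℤ[X])).coeff
          (Module.finrank F V) : ℤ) : ℚ) = (∏ i : MaximalSpectrum (MonoidAlgebra F Q),
        (1 - X ^ Module.finrank F (MonoidAlgebra F Q ⧸ i.asIdeal) : ℚ[X])).coeff
          (Module.finrank F V) := by
    rw [← eq_intCast (Int.castRingHom ℚ), ← coeff_map, Polynomial.map_prod]
    simp
  rw [h2, prod_one_sub_X_pow, finsetSum_coeff]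
  simp only [coeff_C_mul, coeff_X_pow, mul_ite, mul_one, mul_zero]
  rw [← Finset.sum_filter]
  symm
  -- Vectors with entries 0 and 1 and the right dimension all occur; any other vector that occurs
  -- has an entry ≥ 2 and weight 0.
  refine Finset.sum_subset (fun m hm => ?_) fun m hm hm' => ?_
  · obtain ⟨Y, hY⟩ := (exists_mult_repModule_eq_iff m).2 (Finset.mem_filter.1 hm).2.symm
    exact Finset.mem_image.2 ⟨Y, Finset.mem_univ _, hY⟩
  · obtain ⟨Y, -, hY⟩ := Finset.mem_image.1 hm
    have h3 := (exists_mult_repModule_eq_iff (V := V) m).1 ⟨Y, hY⟩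
    have h4 : ∃ i, ¬ m i < 2 := by
      by_contra! h4
      exact hm' (Finset.mem_filter.2 ⟨Fintype.mem_piFinset.2 fun i =>
        Finset.mem_range.2 (h4 i), h3.symm⟩)
    obtain ⟨i, hi⟩ := h4
    refine Finset.prod_eq_zero (Finset.mem_univ i) ?_
    rw [chainMu, if_neg (by omega), if_neg (by omega)]

end Sum

/-! ### Replacing ℤ_p by ℤ/p^N. -/

section Primary

/-- The reduction of `ℤ × ℤ_p^(r-1)` modulo `p^N` in the second factor. -/
noncomputable def primaryReduction (p : ℕ) [Fact p.Prime] (r N : ℕ) :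
    PrimarySource p r →* Multiplicative ℤ × (Fin (r - 1) → Multiplicative (ZMod (p ^ N))) where
  toFun x := (Multiplicative.ofAdd (Multiplicative.toAdd x).1,
    fun j => Multiplicative.ofAdd (PadicInt.toZModPow N ((Multiplicative.toAdd x).2 j)))
  map_one' := by
    refine Prod.ext rfl (funext fun j => ?_)
    exact congrArg Multiplicative.ofAdd (map_zero _)
  map_mul' x y := by
    refine Prod.ext rfl (funext fun j => ?_)
    exact congrArg Multiplicative.ofAdd (map_add _ _ _)

theorem primaryReduction_surjective (p : ℕ) [Fact p.Prime] (r N : ℕ) :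
    Function.Surjective (primaryReduction p r N) := by
  rintro ⟨k, f⟩
  have h : ∀ j, ∃ y : ℤ_[p], PadicInt.toZModPow N y = Multiplicative.toAdd (f j) := fun j =>
    ZMod.ringHom_surjective _ _
  choose y hy using h
  refine ⟨Multiplicative.ofAdd (Multiplicative.toAdd k, y), Prod.ext rfl (funext fun j => ?_)⟩
  exact congrArg Multiplicative.ofAdd (hy j)

theorem ker_primaryReduction_le {p : ℕ} [Fact p.Prime] {r N : ℕ} {G : Type*} [Group G] [Finite G]
    (hN : padicValNat p (Nat.card G) ≤ N) (X : PrimarySource p r →* G) :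
    (primaryReduction p r N).ker ≤ X.ker := by
  have hp : p.Prime := Fact.out
  intro x hx
  obtain ⟨m, hm⟩ : p ^ padicValNat p (Nat.card G) ∣ Nat.card G := pow_padicValNat_dvd
  have hpm : ¬ p ∣ m := by
    intro h
    obtain ⟨c, rfl⟩ := h
    refine pow_succ_padicValNat_not_dvd (p := p) (n := Nat.card G) Nat.card_pos.ne' ⟨c, ?_⟩
    rw [pow_succ, mul_assoc]
    exact hm
  obtain ⟨u, hu⟩ : IsUnit ((m : ℕ) : ℤ_[p]) := by
    rw [PadicInt.isUnit_iff, PadicInt.norm_natCast_eq_one_iff]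
    exact (Nat.Prime.coprime_iff_not_dvd hp).2 hpm
  have hcast : ((Nat.card G : ℕ) : ℤ_[p]) = p ^ padicValNat p (Nat.card G) * u := by
    rw [hu]
    exact_mod_cast congrArg (Nat.cast : ℕ → ℤ_[p]) hm
  have hx1 : (Multiplicative.toAdd x).1 = 0 :=
    congrArg (fun z : Multiplicative ℤ × (Fin (r - 1) → Multiplicative (ZMod (p ^ N))) =>
      Multiplicative.toAdd z.1) hx
  -- Divisibility by p^N suffices, since the prime-to-p part of |G| is a unit in ℤ_p. So x is a
  -- |G|-th power and dies in G.
  have hx2 : ∀ j, ∃ z : ℤ_[p], (Multiplicative.toAdd x).2 j = (Nat.card G : ℕ) • z := by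
    intro j
    have h : PadicInt.toZModPow N ((Multiplicative.toAdd x).2 j) = 0 :=
      congrArg (fun z : Multiplicative ℤ × (Fin (r - 1) → Multiplicative (ZMod (p ^ N))) =>
        Multiplicative.toAdd (z.2 j)) hx
    rw [← RingHom.mem_ker, PadicInt.ker_toZModPow, Ideal.mem_span_singleton] at h
    obtain ⟨z, hz⟩ := h
    refine ⟨(u⁻¹ : ℤ_[p]ˣ) * (p ^ (N - padicValNat p (Nat.card G)) * z), ?_⟩
    rw [nsmul_eq_mul, hz, hcast, mul_assoc, Units.mul_inv_cancel_left, ← mul_assoc, ← pow_add,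
      Nat.add_sub_cancel' hN]
  choose z hz using hx2
  have hxz : x = Multiplicative.ofAdd (0, z) ^ Nat.card G := by
    rw [← ofAdd_nsmul]
    refine Multiplicative.toAdd.injective (Prod.ext ?_ (funext hz))
    rw [hx1]
    simp
  rw [MonoidHom.mem_ker, hxz, map_pow, pow_card_eq_one']

/-- Homomorphisms to a finite group factor through the reduction. -/
noncomputable def primaryHomEquiv {p : ℕ} [Fact p.Prime] {r N : ℕ} {G : Type*} [Group G]
    [Finite G] (hN : padicValNat p (Nat.card G) ≤ N) :
    (Multiplicative ℤ × (Fin (r - 1) → Multiplicative (ZMod (p ^ N))) →* G) ≃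
      (PrimarySource p r →* G) :=
  Equiv.ofBijective (fun X => X.comp (primaryReduction p r N)) ⟨fun _ _ h =>
    (MonoidHom.cancel_right (primaryReduction_surjective p r N)).1 h, fun X =>
    ⟨MonoidHom.liftOfSurjective _ (primaryReduction_surjective p r N)
      ⟨X, ker_primaryReduction_le hN X⟩,
      MonoidHom.liftOfRightInverse_comp _ _ _ _⟩⟩

/-- The invariant subspaces only depend on the image. -/
def fixedProperSubspaceCompIso {H H' F V : Type*} [Group H] [Group H'] [Field F] [AddCommGroup V]
    [Module F V] {π : H' →* H} (hπ : Function.Surjective π)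
    (X : H →* LinearMap.GeneralLinearGroup F V) :
    FixedProperSubspace X ≃o FixedProperSubspace (X.comp π) where
  toFun U := ⟨U.1, U.2.1, fun h => U.2.2 (π h)⟩
  invFun U := ⟨U.1, U.2.1, fun h => by
    obtain ⟨h, rfl⟩ := hπ h
    exact U.2.2 h⟩
  left_inv _ := rfl
  right_inv _ := rfl
  map_rel_iff' := Iff.rfl

end Primary

/-! ### 2-adic valuations, the divisibility theorem, and 2-equivalence. -/

section Arithmetic

open Polynomial

theorem mult_self {A : Type*} [CommRing A] (i : MaximalSpectrum A) : mult A A i = 1 := by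
  rw [mult, (LinearMap.ringLmapEquivSelf A (A ⧸ i.asIdeal) (A ⧸ i.asIdeal)).finrank_eq,
    Module.finrank_self]

theorem sum_finrank_quot {F A : Type*} [Field F] [Finite F] [CommRing A] [Algebra F A] [Finite A]
    [IsSemisimpleRing A] [Fintype (MaximalSpectrum A)] :
    ∑ i : MaximalSpectrum A, Module.finrank F (A ⧸ i.asIdeal) = Module.finrank F A := by
  refine Nat.pow_right_injective (Finite.one_lt_card : 2 ≤ Nat.card F) ?_
  change Nat.card F ^ _ = Nat.card F ^ _
  rw [← Module.natCard_eq_pow_finrank (K := F) (V := A), card_eq_prod_mult (A := A) (V := A),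
    ← Finset.prod_pow_eq_pow_sum]
  refine Finset.prod_congr rfl fun i _ => ?_
  rw [mult_self, pow_one, Module.natCard_eq_pow_finrank (K := F) (V := A ⧸ i.asIdeal)]

theorem gcd_two_pow {x N : ℕ} (hx : x ≠ 0) (hN : padicValNat 2 x ≤ N) :
    x.gcd (2 ^ N) = 2 ^ padicValNat 2 x := by
  obtain ⟨k, hk, hk'⟩ := (Nat.dvd_prime_pow Nat.prime_two).1 (Nat.gcd_dvd_right x (2 ^ N))
  refine Nat.dvd_antisymm ?_ (Nat.dvd_gcd pow_padicValNat_dvd (pow_dvd_pow 2 hN))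
  rw [hk']
  refine pow_dvd_pow 2 ((padicValNat_dvd_iff_le hx).1 ?_)
  rw [← hk']
  exact Nat.gcd_dvd_left _ _

/-- Each squaring multiplies q^(2^m) - 1 by the even number q^(2^m) + 1. -/
theorem padicValNat_pow_two_pow_sub_one {q : ℕ} (hq : 1 < q) (hodd : Odd q) (j k : ℕ) :
    padicValNat 2 (q ^ 2 ^ j - 1) + k ≤ padicValNat 2 (q ^ 2 ^ (j + k) - 1) := by
  induction k with
  | zero => rfl
  | succ k ih =>
    have h1 : ∀ m, 1 < q ^ 2 ^ m := fun m => Nat.one_lt_pow (by positivity) hq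
    have h2 : q ^ 2 ^ (j + (k + 1)) - 1 = (q ^ 2 ^ (j + k) + 1) * (q ^ 2 ^ (j + k) - 1) := by
      rw [← Nat.sq_sub_sq, one_pow, ← pow_mul, ← pow_succ, add_assoc]
    have h3 : 2 ∣ q ^ 2 ^ (j + k) + 1 := (hodd.pow.add_odd odd_one).two_dvd
    have h4 : q ^ 2 ^ (j + k) - 1 ≠ 0 := (Nat.sub_pos_of_lt (h1 _)).ne'
    rw [h2, padicValNat.mul (by omega) h4]
    have := one_le_padicValNat_of_dvd (by omega) h3
    omega

theorem two_ne_zero_of_odd_card {F : Type*} [Field F] [Finite F] (h : Odd (Nat.card F)) :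
    (2 : F) ≠ 0 := by
  intro h2
  have h3 : addOrderOf (1 : F) ∣ 2 := addOrderOf_dvd_of_nsmul_eq_zero (by simpa using h2)
  rcases (Nat.dvd_prime Nat.prime_two).1 h3 with h4 | h4
  · exact one_ne_zero (AddMonoid.addOrderOf_eq_one_iff.1 h4)
  · have h5 := addOrderOf_dvd_natCard (1 : F)
    rw [h4] at h5
    exact (Nat.not_even_iff_odd.2 h) (even_iff_two_dvd.2 h5)

theorem exists_primaryEulerChar_eq {F : Type*} [Field F] [Finite F] {n r s : ℕ} (hn : 1 ≤ n)
    (hodd : Odd (Nat.card F)) (hs : 2 ^ s ∣ Nat.card F - 1) :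
    ∃ k : ℤ, primaryEulerChar 2 r F (Fin n → F) = ((2 ^ ((r - 1) * s) * k : ℤ) : ℚ) := by
  classical
  let q := Nat.card F
  have hq : 1 < q := Finite.one_lt_card
  let v : ℕ → ℕ := fun j => padicValNat 2 (q ^ 2 ^ j - 1)
  have hv : ∀ j k, v j + k ≤ v (j + k) := padicValNat_pow_two_pow_sub_one hq hodd
  have hq0 : ∀ j, q ^ 2 ^ j - 1 ≠ 0 := fun j =>
    (Nat.sub_pos_of_lt (Nat.one_lt_pow (by positivity) hq)).ne'
  let G := LinearMap.GeneralLinearGroup F (Fin n → F)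
  -- Large enough for n < 2^j0 and for N to exceed the valuation of |G|. The choice N = v j0 puts
  -- all 2^N-th roots of unity in the extension of degree 2^j0.
  let j0 := n + padicValNat 2 (Nat.card G)
  let N := v j0
  have hN : padicValNat 2 (Nat.card G) ≤ N := by
    have := hv 0 j0
    rw [zero_add] at this
    omega
  have hnj : n < 2 ^ j0 := Nat.lt_two_pow_self.trans_le (Nat.pow_le_pow_right two_pos (by omega))
  have hv0 : 1 ≤ v 0 := by
    refine one_le_padicValNat_of_dvd (hq0 0) ?_
    rw [pow_zero, pow_one]
    exact (Nat.Odd.sub_odd hodd odd_one).two_dvd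
  have hsv : s ≤ v 0 := by
    refine (padicValNat_dvd_iff_le (hq0 0)).1 ?_
    rwa [pow_zero, pow_one]
  let Q := Fin (r - 1) → Multiplicative (ZMod (2 ^ N))
  have hQ : Nat.card Q = 2 ^ (N * (r - 1)) := by
    rw [Nat.card_pi, Finset.prod_const, Finset.card_univ, Fintype.card_fin, pow_mul]
    exact congrArg (· ^ (r - 1)) (Nat.card_zmod _)
  have : NeZero (Nat.card Q : F) := ⟨by
    rw [hQ, Nat.cast_pow]
    exact pow_ne_zero _ (by exact_mod_cast two_ne_zero_of_odd_card hodd)⟩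
  let A := MonoidAlgebra F Q
  have := Fintype.ofFinite (MaximalSpectrum A)
  let d : MaximalSpectrum A → ℕ := fun i => Module.finrank F (A ⧸ i.asIdeal)
  have : Finite (Multiplicative ℤ × Q →* G) := Finite.of_equiv _ (primaryHomEquiv hN).symm
  have := Fintype.ofFinite (Multiplicative ℤ × Q →* G)
  have := Fintype.ofFinite (PrimarySource 2 r →* G)
  have : Nonempty (Fin n) := ⟨⟨0, hn⟩⟩
  have hmain : primaryEulerChar 2 r F (Fin n → F) =
      ((∏ i, (1 - X ^ d i : ℤ[X])).coeff n : ℤ) := by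
    have h1 := sum_reducedEulerChar_hom (F := F) (V := Fin n → F) (Q := Q)
    rw [Fintype.sum_equiv (primaryHomEquiv hN) _
      (fun X => (reducedEulerChar (FixedProperSubspace X) : ℚ)) fun X => by
        rw [reducedEulerChar_congr
          (fixedProperSubspaceCompIso (primaryReduction_surjective 2 r N) X)]
        rfl, Module.finrank_fin_fun] at h1
    have h2 : (Nat.card G : ℚ) ≠ 0 := Nat.cast_ne_zero.2 Nat.card_pos.ne'
    rw [primaryEulerChar, one_div, inv_mul_eq_iff_eq_mul₀ h2, ← h1]
    congr!
  have hdvd : (2 ^ ((r - 1) * s) : ℤ) ∣ (∏ i, (1 - X ^ d i : ℤ[X])).coeff n := by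
    -- For r = 1 the group Q is trivial and the divisor is 1; the congruence argument needs a
    -- positive exponent.
    rcases (r - 1).eq_zero_or_pos with hr | hr
    · simp [hr]
    obtain ⟨p, hp⟩ := CharP.exists F
    have : Fact p.Prime := ⟨CharP.char_is_prime F p⟩
    have hd : ∀ j ≤ j0, ∑ i, (if d i ∣ 2 ^ j then d i else 0) = 2 ^ ((r - 1) * v j) := by
      intro j hj
      have hjN : v j ≤ N := by
        have := hv j (j0 - j)
        rw [Nat.add_sub_cancel' hj] at this
        omega
      have h1 := card_algHom_eq_sum (F := F) (A := A) (L := FiniteField.Extension F p (2 ^ j))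
      rw [card_monoidAlgebra_algHom, FiniteField.natCard_extension,
        FiniteField.finrank_extension, gcd_two_pow (hq0 j) hjN] at h1
      rw [← h1, ← pow_mul, mul_comm]
    have hall : ∀ i, d i ∣ 2 ^ j0 := by
      -- There are |Q| = dim F[Q] points over the extension of degree 2^j0, so the degrees dividing
      -- 2^j0 already exhaust the dimension.
      have h1 : ∑ i, (if d i ∣ 2 ^ j0 then d i else 0) = ∑ i, d i := by
        rw [hd j0 le_rfl, sum_finrank_quot, mul_comm, ← hQ]
        exact (Module.finrank_eq_nat_card_basis (MonoidAlgebra.basis Q F)).symm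
      intro i
      by_contra hi
      refine h1.not_lt (Finset.sum_lt_sum (fun k _ => ?_) ⟨i, Finset.mem_univ i, ?_⟩)
      · split_ifs <;> simp
      · rw [if_neg hi]
        exact Module.finrank_pos
    refine Dvd.dvd.trans (pow_dvd_pow 2 (Nat.mul_le_mul_left (r - 1) hsv)) ?_
    refine two_pow_dvd_coeff_prod d (fun j => (r - 1) * v j) j0 n ?_ ?_ hd hall hn hnj
    · exact Nat.mul_pos hr hv0
    · intro j _
      have h1 := hv 0 j
      rw [zero_add] at h1
      have h2 := Nat.mul_le_mul_left (r - 1) h1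
      rw [mul_add] at h2
      have h3 := Nat.le_mul_of_pos_left j hr
      exact (Nat.add_le_add_left h3 _).trans h2
  obtain ⟨k, hk⟩ := hdvd
  exact ⟨k, by rw [hmain, hk]⟩

/-- The units congruent to 1 modulo p^k form a closed subgroup; if it contains b it contains the
closure of ⟨b⟩, hence a. -/
theorem PEquivalent.toZModPow_eq_one {p : ℕ} [Fact p.Prime] {a b : ℤ_[p]} (h : PEquivalent p a b)
    {k : ℕ} (hb : PadicInt.toZModPow k b = 1) : PadicInt.toZModPow k a = 1 := by
  obtain ⟨u, v, rfl, rfl, h⟩ := h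
  let S : Subgroup ℤ_[p]ˣ := (Units.map (PadicInt.toZModPow (p := p) k).toMonoidHom).ker
  have hS : ∀ x : ℤ_[p]ˣ, x ∈ S ↔ PadicInt.toZModPow k (x : ℤ_[p]) = 1 := fun x => by
    rw [MonoidHom.mem_ker, Units.ext_iff]
    rfl
  have hclosed : IsClosed (S : Set ℤ_[p]ˣ) := by
    have h1 : (S : Set ℤ_[p]ˣ) = {x : ℤ_[p]ˣ | ‖(x : ℤ_[p]) - 1‖ ≤ (p : ℝ) ^ (-k : ℤ)} := by
      ext x
      rw [SetLike.mem_coe, hS, Set.mem_ofPred_eq, PadicInt.norm_le_pow_iff_mem_span_pow,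
        ← PadicInt.ker_toZModPow, RingHom.mem_ker, map_sub, map_one, sub_eq_zero]
    rw [h1]
    exact isClosed_le (by fun_prop) continuous_const
  have hle : (Subgroup.zpowers v).topologicalClosure ≤ S :=
    Subgroup.topologicalClosure_minimal _ ((Subgroup.zpowers_le).2 ((hS v).2 hb)) hclosed
  refine (hS u).1 (hle ?_)
  rw [← h]
  exact Subgroup.le_topologicalClosure _ (Subgroup.mem_zpowers u)

theorem PEquivalent.pow_dvd_sub_one {q k : ℕ} {b : ℤ_[2]} (h : PEquivalent 2 q b) (hq : 1 ≤ q)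
    (hb : PadicInt.toZModPow k b = 1) : 2 ^ k ∣ q - 1 := by
  have h1 := h.toZModPow_eq_one hb
  rw [map_natCast] at h1
  rw [← ZMod.natCast_eq_zero_iff, Nat.cast_sub hq, h1, Nat.cast_one, sub_self]

theorem PEquivalent.odd {q : ℕ} {b : ℤ_[2]} (h : PEquivalent 2 q b) : Odd q := by
  obtain ⟨u, -, hu, -⟩ := h
  have h1 : IsUnit ((q : ℕ) : ℤ_[2]) := ⟨u, hu⟩
  rw [PadicInt.isUnit_iff, PadicInt.norm_natCast_eq_one_iff] at h1
  exact Nat.coprime_two_left.1 h1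

/-- Starts from 8 ∣ 3^2 - 1, with one more factor 2 for each squaring. The shift e + 1 is needed: 4
does not divide 3 - 1. -/
theorem two_pow_dvd_three_pow_sub_one (e : ℕ) : (2 : ℤ) ^ (2 + (e + 1)) ∣ 3 ^ 2 ^ (e + 1) - 1 := by
  induction e with
  | zero => norm_num
  | succ e ih =>
    have h1 : (2 : ℤ) ∣ 3 ^ 2 ^ (e + 1) + 1 := by
      have : Odd ((3 : ℤ) ^ 2 ^ (e + 1)) := Odd.pow (by decide)
      exact (this.add_odd odd_one).two_dvd
    have h2 := mul_dvd_mul ih h1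
    rw [← pow_succ] at h2
    refine h2.trans (dvd_of_eq ?_)
    rw [pow_succ 2 (e + 1), pow_mul]
    ring

theorem toZModPow_three_pow {e : ℕ} (he : 0 < e) :
    PadicInt.toZModPow (2 + e) (3 ^ 2 ^ e : ℤ_[2]) = 1 := by
  obtain ⟨e, rfl⟩ := Nat.exists_eq_succ_of_ne_zero he.ne'
  have h := two_pow_dvd_three_pow_sub_one e
  have h1 : ((3 ^ 2 ^ (e + 1) - 1 : ℤ) : ZMod (2 ^ (2 + (e + 1)))) = 0 := by
    rw [ZMod.intCast_zmod_eq_zero_iff_dvd]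
    exact_mod_cast h
  push_cast at h1
  rw [map_pow, map_ofNat]
  exact sub_eq_zero.1 h1

end Arithmetic

/-! ### The four cases. -/

theorem mainTheorem7 (n r e : ℕ) (hn : 1 ≤ n) (hr : 1 ≤ r) (he : 0 < e)
    (F : Type*) [Field F] [Finite F] :
    (PEquivalent 2 (Nat.card F : ℤ_[2]) (-3) →
      ∃ k : ℤ, primaryEulerChar 2 r F (Fin n → F) = ((4 ^ (r - 1) * k : ℤ) : ℚ)) ∧
    (PEquivalent 2 (Nat.card F : ℤ_[2]) (3 ^ 2 ^ e) →
      ∃ k : ℤ, primaryEulerChar 2 r F (Fin n → F) = ((2 ^ ((r - 1) * (2 + e)) * k : ℤ) : ℚ)) ∧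
    (PEquivalent 2 (Nat.card F : ℤ_[2]) 3 →
      ∃ k : ℤ, primaryEulerChar 2 r F (Fin n → F) = ((2 ^ (r - 1) * k : ℤ) : ℚ)) ∧
    (PEquivalent 2 (Nat.card F : ℤ_[2]) (-(3 ^ 2 ^ e)) →
      ∃ k : ℤ, primaryEulerChar 2 r F (Fin n → F) = ((2 ^ (r - 1) * k : ℤ) : ℚ)) := by
  have hq : 1 ≤ Nat.card F := Finite.one_lt_card.le
  have hodd : Odd (Nat.card F) →
      ∃ k : ℤ, primaryEulerChar 2 r F (Fin n → F) = ((2 ^ (r - 1) * k : ℤ) : ℚ) := fun h => by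
    have := exists_primaryEulerChar_eq (r := r) (s := 1) hn h
      (by rw [pow_one]; exact (Nat.Odd.sub_odd h odd_one).two_dvd)
    rwa [mul_one] at this
  -- The last two cases use only that q - 1 is even; the first two use -3 ≡ 1 modulo 4 and 3^(2^e) ≡
  -- 1 modulo 2^(2+e).
  refine ⟨fun h => ?_, fun h => ?_, fun h => hodd h.odd, fun h => hodd h.odd⟩
  · have h1 : PadicInt.toZModPow 2 (-3 : ℤ_[2]) = 1 := by
      rw [map_neg, map_ofNat]
      decide
    have := exists_primaryEulerChar_eq (r := r) hn h.odd (h.pow_dvd_sub_one hq h1)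
    rw [mul_comm, pow_mul] at this
    exact_mod_cast this
  · exact exists_primaryEulerChar_eq hn h.odd (h.pow_dvd_sub_one hq (toZModPow_three_pow he))
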